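/- Let $a,b>0$ be real numbers with $ab$ rational and let $g\in L^2(\mathbb R)$ (complex-valued). For $m,n\in\mathbb Z$ put $g_{m,n}(t)=e^{2\pi i m b t}g(t-na)$. Suppose that $(g,a,b)$ is a Weyl–Heisenberg frame, i.e. there are constants $0<A,B<\infty$ with $$A\|f\|^2\le\sum_{m,n\in\mathbb Z}|\langle f,g_{m,n}\rangle|^2\le B\|f\|^2\qquad\text{for all } f\in L^2(\mathbb R),$$ and let $S f=\sum_{m,n\in\mathbb Z}\langle f,g_{m,n}\rangle g_{m,n}$ be its frame operator, an invertible operator on $L^2(\mathbb R)$. For $h\in L^2(\mathbb R)$, say that $h$ (more precisely, $(h,a,b)$) satisfies the *uniform CC-condition* if the system $(e^{2\pi i m b t}h(t-na))_{m,n\in\mathbb Z}$ has a finite upper frame bound (the right-hand inequality above holds for it with some finite constant) and for every $\varepsilon>0$ there is an integer $K>0$ such that for almost every $t\in\mathbb R$ $$\sum_{k\in\mathbb Z,\ |k|\ge K}\Big|\sum_{n\in\mathbb Z}h(t-na)\,\overline{h(t-na-k/b)}\Big|<\varepsilon .$$ If $g$ satisfies the uniform CC-condition, then its canonical dual window $S^{-1}g$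 also satisfies the uniform CC-condition. -/

import Mathlib

open MeasureTheory

noncomputable section

namespace WeylHeisenberg

/-! ### Frames and the frame operator in a complex Hilbert space -/

section Frames

variable {ι H : Type*} [NormedAddCommGroup H] [InnerProductSpace ℂ H]

/-- The family `φ` has a finite upper frame bound: there is `B > 0` with
`∑ |⟨f, φ i⟩|² ≤ B ‖f‖²` (in particular the sum converges) for all `f`.
Mathlib's inner product is linear in the second slot, so `⟨f, φ i⟩` is `inner ℂ (φ i) f`. -/
def HasUpperFrameBound (φ : ι → H) : Prop :=
  ∃ B : ℝ, 0 < B ∧ ∀ f : H, Summable (fun i => ‖inner ℂ (φ i) f‖ ^ 2) ∧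
    ∑' i, ‖inner ℂ (φ i) f‖ ^ 2 ≤ B * ‖f‖ ^ 2

/-- The family `φ` is a frame: `A ‖f‖² ≤ ∑ |⟨f, φ i⟩|² ≤ B ‖f‖²` for all `f`, with constants
`A > 0` and `B < ∞`. -/
def IsFrame (φ : ι → H) : Prop :=
  ∃ A B : ℝ, 0 < A ∧ 0 < B ∧ ∀ f : H, Summable (fun i => ‖inner ℂ (φ i) f‖ ^ 2) ∧
    A * ‖f‖ ^ 2 ≤ ∑' i, ‖inner ℂ (φ i) f‖ ^ 2 ∧
    ∑' i, ‖inner ℂ (φ i) f‖ ^ 2 ≤ B * ‖f‖ ^ 2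

/-- The frame operator `S f = ∑ ⟨f, φ i⟩ φ i` (unconditional norm convergence in `H`, which
holds whenever there is a finite upper frame bound, see `hasSum_frameOperator`). -/
def frameOperator (φ : ι → H) (f : H) : H :=
  ∑' i, inner ℂ (φ i) f • φ i

theorem IsFrame.hasUpperFrameBound {φ : ι → H} (h : IsFrame φ) : HasUpperFrameBound φ := by
  obtain ⟨A, B, _, hB, h⟩ := h
  exact ⟨B, hB, fun f => ⟨(h f).1, (h f).2.2⟩⟩

variable [CompleteSpace H]

/-- A family with a finite upper frame bound has a bounded frame operator, given by
unconditionally convergent series. -/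
theorem HasUpperFrameBound.exists_clm {φ : ι → H} (h : HasUpperFrameBound φ) :
    ∃ S : H →L[ℂ] H, ∀ f, HasSum (fun i => inner ℂ (φ i) f • φ i) (S f) := by
  classical
  obtain ⟨B, hB, h⟩ := h
  have h2 : (0 : ℝ) < (2 : ENNReal).toReal := by norm_num
  have hmem : ∀ f : H, Memℓp (E := fun _ : ι => ℂ) (fun i => inner ℂ (φ i) f) 2 := fun f =>
    memℓp_gen (by simpa using (h f).1)
  let C₀ : H →ₗ[ℂ] lp (fun _ : ι => ℂ) 2 :=
    { toFun := fun f => ⟨fun i => inner ℂ (φ i) f, hmem f⟩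
      map_add' := fun f g => by
        ext i
        exact inner_add_right _ _ _
      map_smul' := fun c f => by
        ext i
        exact inner_smul_right _ _ _ }
  have hC₀ : ∀ f i, C₀ f i = inner ℂ (φ i) f := fun f i => rfl
  have hbound : ∀ f, ‖C₀ f‖ ≤ Real.sqrt B * ‖f‖ := by
    intro f
    have h1 := lp.norm_rpow_eq_tsum h2 (C₀ f)
    simp only [hC₀, ENNReal.toReal_ofNat, Real.rpow_ofNat] at h1
    refine (sq_le_sq₀ (norm_nonneg _) (by positivity)).1 ?_
    rw [h1, mul_pow, Real.sq_sqrt hB.le]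
    exact (h f).2
  let C : H →L[ℂ] lp (fun _ : ι => ℂ) 2 := C₀.mkContinuous _ hbound
  refine ⟨(ContinuousLinearMap.adjoint C).comp C, fun f => ?_⟩
  have hs := (lp.hasSum_single (E := fun _ : ι => ℂ) (p := 2) (by norm_num) (C f)).mapL
    (ContinuousLinearMap.adjoint C)
  have he : ∀ i, ContinuousLinearMap.adjoint C (lp.single 2 i (C f i)) =
      (inner ℂ (φ i) f : ℂ) • φ i := by
    intro i
    refine ext_inner_right ℂ fun v => ?_
    rw [ContinuousLinearMap.adjoint_inner_left, lp.inner_single_left]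
    change inner ℂ (inner ℂ (φ i) f) (inner ℂ (φ i) v) = _
    rw [inner_smul_left, RCLike.inner_apply, mul_comm]
  simp only [he] at hs
  exact hs

theorem HasUpperFrameBound.hasSum_frameOperator {φ : ι → H} (h : HasUpperFrameBound φ) (f : H) :
    HasSum (fun i => inner ℂ (φ i) f • φ i) (frameOperator φ f) := by
  obtain ⟨S, hS⟩ := h.exists_clm
  exact (hS f).summable.hasSum

/-- The frame operator of a frame is invertible. -/
theorem IsFrame.bijective_frameOperator {φ : ι → H} (h : IsFrame φ) :
    Function.Bijective (frameOperator φ) := by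
  obtain ⟨S, hS⟩ := h.hasUpperFrameBound.exists_clm
  have hSe : frameOperator φ = S := funext fun f => (hS f).tsum_eq
  rw [hSe, ← ContinuousLinearMap.isUnit_iff_bijective]
  obtain ⟨A, B, hA, _, h⟩ := h
  refine S.isUnit_of_forall_le_norm_inner_map (c := ⟨A, hA.le⟩) hA fun f => ?_
  have h1 : HasSum (fun i => ((‖inner ℂ (φ i) f‖ ^ 2 : ℝ) : ℂ)) (inner ℂ f (S f)) := by
    have h3 := (hS f).mapL (innerSL ℂ f)
    have h4 : ∀ i, innerSL ℂ f (inner ℂ (φ i) f • φ i) = ((‖inner ℂ (φ i) f‖ ^ 2 : ℝ) : ℂ) := by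
      intro i
      rw [innerSL_apply_apply, inner_smul_right, ← inner_conj_symm f (φ i), RCLike.mul_conj]
      push_cast
      rfl
    simpa only [h4, innerSL_apply_apply] using h3
  have h2 : (inner ℂ f (S f) : ℂ) = ((∑' i, ‖inner ℂ (φ i) f‖ ^ 2 : ℝ) : ℂ) :=
    h1.unique (Complex.hasSum_ofReal.mpr (h f).1.hasSum)
  rw [norm_inner_symm, h2, Complex.norm_real, mul_comm]
  exact (h f).2.1.trans (le_abs_self _)

/-- The frame operator `S` of a frame, as a bijection of `H`; its inverse `S⁻¹` is `.symm`. -/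
def IsFrame.frameEquiv {φ : ι → H} (h : IsFrame φ) : H ≃ H :=
  Equiv.ofBijective (frameOperator φ) h.bijective_frameOperator

end Frames

/-! ### Weyl–Heisenberg systems -/

/-- The complex Hilbert space `L²(ℝ)`. -/
abbrev L2R : Type := Lp ℂ 2 (volume : Measure ℝ)

theorem memLp_translate_modulate (x ω : ℝ) (g : L2R) :
    MemLp (fun t : ℝ => Complex.exp (2 * Real.pi * Complex.I * ω * t) * g (t - x)) 2 volume := by
  have h := (Lp.memLp g).comp_measurePreserving (measurePreserving_sub_right volume x)
  refine h.of_le (AEStronglyMeasurable.mul ?_ h.1) (Filter.Eventually.of_forall fun t => ?_)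
  · exact Continuous.aestronglyMeasurable (by fun_prop)
  · have : (2 * Real.pi * Complex.I * ω * t : ℂ) = ((2 * Real.pi * ω * t : ℝ) : ℂ) * Complex.I := by
      push_cast
      ring
    rw [norm_mul, this, Complex.norm_exp_ofReal_mul_I, one_mul]
    rfl

/-- The time-frequency shift `E_ω T_x g (t) = e^{2πiωt} g(t - x)` of `g ∈ L²(ℝ)`. -/
def modTrans (ω x : ℝ) (g : L2R) : L2R :=
  (memLp_translate_modulate x ω g).toLp _

/-- The Weyl–Heisenberg system `(E_{mb} T_{na} g)_{m,n ∈ ℤ}`. -/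
def whSystem (g : L2R) (a b : ℝ) : ℤ × ℤ → L2R :=
  fun mn => modTrans (mn.1 * b) (mn.2 * a) g

/-- The functions `G_k(t) = ∑_n g(t - na) conj (g(t - na - k/b))`. For `g ∈ L²(ℝ)` and `a > 0`
the series converges absolutely for almost every `t`. -/
def corr (g : L2R) (a b : ℝ) (k : ℤ) (t : ℝ) : ℂ :=
  ∑' n : ℤ, g (t - n * a) * starRingEnd ℂ (g (t - n * a - k / b))

/-- The uniform CC-condition for `(g, a, b)`: the system has a finite upper frame bound, and for
every `ε > 0` there is `K > 0` such that `∑_{|k| ≥ K} |G_k(t)| < ε` for almost every `t`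
(the sum is taken in `[0, ∞]`, so the inequality includes convergence). -/
def UniformCC (g : L2R) (a b : ℝ) : Prop :=
  HasUpperFrameBound (whSystem g a b) ∧
    ∀ ε : ℝ, 0 < ε → ∃ K : ℕ, 0 < K ∧ ∀ᵐ t : ℝ,
      ∑' k : {k : ℤ // (K : ℤ) ≤ |k|}, ‖corr g a b k t‖ₑ < ENNReal.ofReal ε

end WeylHeisenberg

end

/-!
On almost every fibre `t + ℤ / b` the frame operator `S` acts by the matrix
`M_t (j, l) = b⁻¹ G_{j - l} (t + j / b)` (Walnut's representation), and the lower frame bound says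
that these matrices are coercive, uniformly in `t`. Applied to the dual window, whose frame operator
is `S⁻¹`, the same representation shows that the correlation functions of the dual are, up to the
factor `b`, the entries of the zeroth column of `M_t⁻¹`.

Each `G_k` is `a`-periodic and `a b` is rational, so along a fibre `G_k` takes only finitely many
values and `|M_t (j, l)| ≤ m_t (j - l)` with `m_t` summable over `ℤ`, the tails being small
uniformly in `t`. A uniform form of Wiener's lemma then transfers the uniform smallness of the tails
to the columns of the inverse: the commutator of `M_t` with a cutoff varying on the scale `L` is
small for large `L`, so coercivity localises to blocks of length `L`.
-/

noncomputable section

namespace WeylHeisenberg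

open Filter
open scoped ENNReal Topology

/-! ### Uniformly summable families -/

section UniformlySummable

/-- The part of the sum of `a` over `|k| ≥ K`. -/
def tail (a : ℤ → ℝ≥0∞) (K : ℕ) : ℝ≥0∞ := ∑' k : {k : ℤ // (K : ℤ) ≤ |k|}, a k

theorem tail_eq_tsum_indicator (a : ℤ → ℝ≥0∞) (K : ℕ) :
    tail a K = ∑' k, {k : ℤ | (K : ℤ) ≤ |k|}.indicator a k :=
  tsum_subtype {k : ℤ | (K : ℤ) ≤ |k|} a

theorem tail_le_tsum (a : ℤ → ℝ≥0∞) (K : ℕ) : tail a K ≤ ∑' k, a k :=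
  ENNReal.tsum_comp_le_tsum_of_injective Subtype.val_injective a

theorem tail_mono {a a' : ℤ → ℝ≥0∞} (h : ∀ k, a k ≤ a' k) (K : ℕ) : tail a K ≤ tail a' K :=
  ENNReal.tsum_le_tsum fun k => h k

theorem tail_anti (a : ℤ → ℝ≥0∞) : Antitone (tail a) := fun _ _ h =>
  ENNReal.tsum_mono_subtype a fun k (hk : _ ≤ |k|) => (Nat.cast_le.2 h).trans hk

theorem tsum_le_sum_add_tail (a : ℤ → ℝ≥0∞) (K : ℕ) :
    ∑' k, a k ≤ ∑ k ∈ Finset.Icc (-K : ℤ) K, a k + tail a K := by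
  have hcover : (Set.univ : Set ℤ) ⊆ ↑(Finset.Icc (-K : ℤ) K) ∪ {k : ℤ | (K : ℤ) ≤ |k|} := by
    intro k _
    rw [Finset.coe_Icc, Set.mem_union, Set.mem_Icc, ← abs_le]
    exact le_total _ _
  calc ∑' k, a k = ∑' k : (Set.univ : Set ℤ), a k := (tsum_univ a).symm
    _ ≤ ∑' k : ↥(↑(Finset.Icc (-K : ℤ) K) ∪ {k : ℤ | (K : ℤ) ≤ |k|}), a k :=
        ENNReal.tsum_mono_subtype a hcover
    _ ≤ ∑' k : ↥(Finset.Icc (-K : ℤ) K), a k + tail a K := ENNReal.tsum_union_le a _ _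
    _ = ∑ k ∈ Finset.Icc (-K : ℤ) K, a k + tail a K := by rw [Finset.tsum_subtype]

theorem exists_ne_zero_mul_le {c δ : ℝ≥0∞} (hc : c ≠ ⊤) (hδ : δ ≠ 0) :
    ∃ ε ≠ 0, c * ε ≤ δ :=
  ⟨δ / c, ENNReal.div_ne_zero.2 ⟨hδ, hc⟩, ENNReal.mul_div_le⟩

variable {Ω Ω' ι : Type*} {l : Filter Ω} {a a' : Ω → ℤ → ℝ≥0∞}

/-- Families `a ω` of nonnegative sequences which, eventually along `l`, have uniformly bounded
sums and uniformly small tails. For `l = ae μ` the conditions hold for almost every `ω`, with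
bounds and tail indices independent of `ω`. -/
def UniformlySummable (l : Filter Ω) (a : Ω → ℤ → ℝ≥0∞) : Prop :=
  (∃ C ≠ ⊤, ∀ᶠ ω in l, ∑' k, a ω k ≤ C) ∧ ∀ ε ≠ 0, ∃ K, ∀ᶠ ω in l, tail (a ω) K ≤ ε

theorem UniformlySummable.of_bounded
    (hbdd : ∀ k, ∃ C ≠ ⊤, ∀ᶠ ω in l, a ω k ≤ C)
    (htail : ∀ ε ≠ 0, ∃ K, ∀ᶠ ω in l, tail (a ω) K ≤ ε) : UniformlySummable l a := by
  refine ⟨?_, htail⟩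
  obtain ⟨K, hK⟩ := htail 1 one_ne_zero
  choose C hC haC using hbdd
  refine ⟨∑ k ∈ Finset.Icc (-K : ℤ) K, C k + 1,
    ENNReal.add_ne_top.2 ⟨ENNReal.sum_ne_top.2 fun k _ => hC k, ENNReal.one_ne_top⟩, ?_⟩
  filter_upwards [hK, eventually_all_finset (Finset.Icc (-K : ℤ) K) |>.2 fun k _ => haC k]
    with ω hω haω
  exact (tsum_le_sum_add_tail _ K).trans (add_le_add (Finset.sum_le_sum haω) hω)

theorem UniformlySummable.mono (ha : UniformlySummable l a)
    (h : ∀ᶠ ω in l, ∀ k, a' ω k ≤ a ω k) : UniformlySummable l a' := by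
  refine ⟨?_, fun ε hε => ?_⟩
  · obtain ⟨C, hC, haC⟩ := ha.1
    refine ⟨C, hC, ?_⟩
    filter_upwards [h, haC] with ω hω haω using (ENNReal.tsum_le_tsum hω).trans haω
  · obtain ⟨K, hK⟩ := ha.2 ε hε
    refine ⟨K, ?_⟩
    filter_upwards [h, hK] with ω hω haω using (tail_mono hω K).trans haω

theorem UniformlySummable.comp_tendsto (ha : UniformlySummable l a) {l' : Filter Ω'} {u : Ω' → Ω}
    (hu : Tendsto u l' l) : UniformlySummable l' fun ω => a (u ω) :=
  ⟨ha.1.imp fun _ hC => hC.imp_right hu.eventually,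
    fun ε hε => (ha.2 ε hε).imp fun _ hK => hu.eventually hK⟩

theorem UniformlySummable.const_mul (ha : UniformlySummable l a) {c : ℝ≥0∞} (hc : c ≠ ⊤) :
    UniformlySummable l fun ω k => c * a ω k := by
  refine ⟨?_, fun ε hε => ?_⟩
  · obtain ⟨C, hC, haC⟩ := ha.1
    refine ⟨c * C, ENNReal.mul_ne_top hc hC, ?_⟩
    filter_upwards [haC] with ω haω
    rw [ENNReal.tsum_mul_left]
    gcongr
  · obtain ⟨η, hη, hηε⟩ := exists_ne_zero_mul_le hc hε
    obtain ⟨K, hK⟩ := ha.2 η hη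
    refine ⟨K, ?_⟩
    filter_upwards [hK] with ω haω
    rw [tail, ENNReal.tsum_mul_left]
    exact (mul_le_mul_right haω c).trans hηε

theorem UniformlySummable.add (ha : UniformlySummable l a) (ha' : UniformlySummable l a') :
    UniformlySummable l fun ω k => a ω k + a' ω k := by
  refine ⟨?_, fun ε hε => ?_⟩
  · obtain ⟨C, hC, haC⟩ := ha.1
    obtain ⟨C', hC', haC'⟩ := ha'.1
    refine ⟨C + C', ENNReal.add_ne_top.2 ⟨hC, hC'⟩, ?_⟩
    filter_upwards [haC, haC'] with ω haω haω'
    rw [ENNReal.tsum_add]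
    exact add_le_add haω haω'
  · obtain ⟨K, hK⟩ := ha.2 (ε / 2) (ENNReal.half_pos hε).ne'
    obtain ⟨K', hK'⟩ := ha'.2 (ε / 2) (ENNReal.half_pos hε).ne'
    refine ⟨max K K', ?_⟩
    filter_upwards [hK, hK'] with ω haω haω'
    rw [tail, ENNReal.tsum_add, ← ENNReal.add_halves ε]
    exact add_le_add ((tail_anti _ (le_max_left _ _)).trans haω)
      ((tail_anti _ (le_max_right _ _)).trans haω')

theorem UniformlySummable.sum (s : Finset ι) {a : ι → Ω → ℤ → ℝ≥0∞}
    (ha : ∀ i ∈ s, UniformlySummable l (a i)) :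
    UniformlySummable l fun ω k => ∑ i ∈ s, a i ω k := by
  classical
  induction s using Finset.induction_on with
  | empty =>
    exact ⟨⟨0, ENNReal.zero_ne_top, by simp⟩, fun ε _ => ⟨0, by simp [tail]⟩⟩
  | insert i s hi ih =>
    simp only [Finset.sum_insert hi]
    exact (ha i (Finset.mem_insert_self i s)).add
      (ih fun j hj => ha j (Finset.mem_insert_of_mem hj))

theorem UniformlySummable.comp_neg (ha : UniformlySummable l a) :
    UniformlySummable l fun ω k => a ω (-k) := by
  have htail : ∀ ω K, tail (fun k => a ω (-k)) K = tail (a ω) K := fun ω K =>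
    ((Equiv.neg ℤ).subtypeEquiv fun k => by simp).tsum_eq
      fun k : {k : ℤ // (K : ℤ) ≤ |k|} => a ω k
  refine ⟨?_, ?_⟩
  · have hsum : ∀ ω, ∑' k, a ω (-k) = ∑' k, a ω k := fun ω => (Equiv.neg ℤ).tsum_eq (a ω)
    simpa only [hsum] using ha.1
  · simpa only [htail] using ha.2

theorem tsum_tsum_indicator_le {P : ℤ → ℤ → Prop} {N : ℕ} (hN : ∀ k, {i | P i k}.encard ≤ N)
    (u : ℤ → ℝ≥0∞) : ∑' i, ∑' k, {k | P i k}.indicator u k ≤ N * ∑' k, u k := by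
  rw [ENNReal.tsum_comm, ← ENNReal.tsum_mul_left]
  refine ENNReal.tsum_le_tsum fun k => ?_
  calc ∑' i, {k | P i k}.indicator u k = ∑' i, {i | P i k}.indicator (fun _ => u k) i := rfl
    _ = {i | P i k}.encard * u k := by rw [← tsum_subtype, ENNReal.tsum_const, Set.encard]
    _ ≤ N * u k := by
        gcongr
        exact_mod_cast hN k

theorem UniformlySummable.tsum_related (ha : UniformlySummable l a) {P : ℤ → ℤ → Prop}
    {N : ℕ} (hN : ∀ k, {i | P i k}.encard ≤ N)
    (hP : ∀ K : ℕ, ∃ K' : ℕ, ∀ i k, P i k → (K' : ℤ) ≤ |i| → (K : ℤ) ≤ |k|) :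
    UniformlySummable l fun ω i => ∑' k, {k | P i k}.indicator (a ω) k := by
  refine ⟨?_, fun ε hε => ?_⟩
  · obtain ⟨C, hC, haC⟩ := ha.1
    refine ⟨N * C, ENNReal.mul_ne_top (ENNReal.natCast_ne_top N) hC, ?_⟩
    filter_upwards [haC] with ω haω
    exact (tsum_tsum_indicator_le hN _).trans (mul_le_mul_right haω _)
  · obtain ⟨η, hη, hηε⟩ := exists_ne_zero_mul_le (ENNReal.natCast_ne_top N) hε
    obtain ⟨K, hK⟩ := ha.2 η hη
    obtain ⟨K', hK'⟩ := hP K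
    refine ⟨K', ?_⟩
    filter_upwards [hK] with ω haω
    refine le_trans ?_ ((mul_le_mul_right haω N).trans hηε)
    rw [tail_eq_tsum_indicator, tail_eq_tsum_indicator]
    refine le_trans ?_ (tsum_tsum_indicator_le hN _)
    refine ENNReal.tsum_le_tsum fun i => Set.indicator_apply_le' (fun hi => ?_) fun _ => zero_le
    refine ENNReal.tsum_le_tsum fun k => Set.indicator_apply_le' (fun hk => ?_) fun _ => zero_le
    have hfar : k ∈ {k : ℤ | (K : ℤ) ≤ |k|} := hK' i k hk hi
    rw [Set.indicator_of_mem hk, Set.indicator_of_mem hfar]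

end UniformlySummable

/-! ### Contractive convolution inequalities -/

section Convolution

/-- The convolution of two nonnegative sequences on `ℤ`. -/
def conv (κ x : ℤ → ℝ≥0∞) (i : ℤ) : ℝ≥0∞ := ∑' i', κ (i - i') * x i'

theorem conv_add (κ x y : ℤ → ℝ≥0∞) (i : ℤ) :
    conv κ (fun i => x i + y i) i = conv κ x i + conv κ y i := by
  simp only [conv, mul_add, ENNReal.tsum_add]

theorem conv_const (κ : ℤ → ℝ≥0∞) (c : ℝ≥0∞) (i : ℤ) :
    conv κ (fun _ => c) i = (∑' k, κ k) * c := by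
  rw [conv, ENNReal.tsum_mul_right, ← (Equiv.subLeft i).tsum_eq κ]
  rfl

theorem tsum_conv (κ x : ℤ → ℝ≥0∞) : ∑' i, conv κ x i = (∑' k, κ k) * ∑' i, x i := by
  simp only [conv]
  rw [ENNReal.tsum_comm, ← ENNReal.tsum_mul_left]
  refine tsum_congr fun i' => ?_
  rw [ENNReal.tsum_mul_right, ← (Equiv.subRight i').tsum_eq κ]
  rfl

theorem conv_mono {κ κ' x x' : ℤ → ℝ≥0∞} (hκ : ∀ k, κ k ≤ κ' k) (hx : ∀ i, x i ≤ x' i) (i : ℤ) :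
    conv κ x i ≤ conv κ' x' i :=
  ENNReal.tsum_le_tsum fun i' => mul_le_mul' (hκ _) (hx i')

theorem conv_const_mul (c : ℝ≥0∞) (κ x : ℤ → ℝ≥0∞) (i : ℤ) :
    conv (fun k => c * κ k) x i = c * conv κ x i := by
  simp only [conv, mul_assoc, ENNReal.tsum_mul_left]

theorem tail_conv_le (κ x : ℤ → ℝ≥0∞) (I J : ℕ) :
    tail (conv κ x) (I + J) ≤ (∑' k, κ k) * tail x I + tail κ J * ∑' i, x i := by
  set xI := {i : ℤ | (I : ℤ) ≤ |i|}.indicator x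
  set κJ := {k : ℤ | (J : ℤ) ≤ |k|}.indicator κ
  have hsplit : ∀ i : ℤ, ((I + J : ℕ) : ℤ) ≤ |i| → conv κ x i ≤ conv κ xI i + conv κJ x i := by
    intro i hi
    rw [conv, conv, conv, ← ENNReal.tsum_add]
    refine ENNReal.tsum_le_tsum fun i' => ?_
    have hfar : (I : ℤ) ≤ |i'| ∨ (J : ℤ) ≤ |i - i'| := by
      have := abs_sub_abs_le_abs_sub i i'
      push_cast at hi
      omega
    rcases hfar with h | h
    · have hxI : xI i' = x i' := Set.indicator_of_mem (s := {i : ℤ | (I : ℤ) ≤ |i|}) h x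
      rw [hxI]
      exact le_self_add
    · have hκJ : κJ (i - i') = κ (i - i') :=
        Set.indicator_of_mem (s := {k : ℤ | (J : ℤ) ≤ |k|}) h κ
      rw [hκJ]
      exact le_add_self
  calc tail (conv κ x) (I + J) ≤ tail (fun i => conv κ xI i + conv κJ x i) (I + J) :=
        ENNReal.tsum_le_tsum fun i => hsplit i i.2
    _ ≤ ∑' i, conv κ xI i + ∑' i, conv κJ x i := by
        rw [← ENNReal.tsum_add]
        exact tail_le_tsum _ _
    _ = (∑' k, κ k) * tail x I + tail κ J * ∑' i, x i := by
        rw [tsum_conv, tsum_conv, tail_eq_tsum_indicator, tail_eq_tsum_indicator]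

variable {κ x y : ℤ → ℝ≥0∞}

theorem exists_le_add_two_inv_pow {X : ℝ≥0∞} (hx : ∀ i, x i ≤ X) (hκ : ∑' k, κ k ≤ 2⁻¹)
    (hle : ∀ i, x i ≤ y i + conv κ x i) (N : ℕ) :
    ∃ s : ℤ → ℝ≥0∞, ∑' i, s i ≤ 2 * ∑' i, y i ∧ ∀ i, x i ≤ s i + 2⁻¹ ^ N * X := by
  induction N with
  | zero => exact ⟨0, by simp, fun i => by simpa using hx i⟩
  | succ N ih =>
    obtain ⟨s, hs, hxs⟩ := ih
    refine ⟨fun i => y i + conv κ s i, ?_, fun i => ?_⟩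
    · calc ∑' i, (y i + conv κ s i) = ∑' i, y i + (∑' k, κ k) * ∑' i, s i := by
            rw [ENNReal.tsum_add, tsum_conv]
        _ ≤ ∑' i, y i + 2⁻¹ * (2 * ∑' i, y i) := by gcongr
        _ = 2 * ∑' i, y i := by
            rw [← mul_assoc, ENNReal.inv_mul_cancel (by simp) (by simp), one_mul, two_mul]
    · calc x i ≤ y i + conv κ x i := hle i
        _ ≤ y i + conv κ (fun i => s i + 2⁻¹ ^ N * X) i := by
            gcongr
            exact conv_mono (fun _ => le_rfl) hxs i
        _ = y i + conv κ s i + (∑' k, κ k) * (2⁻¹ ^ N * X) := by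
            rw [conv_add, conv_const, add_assoc]
        _ ≤ y i + conv κ s i + 2⁻¹ ^ (N + 1) * X := by
            rw [pow_succ', mul_assoc]
            gcongr

theorem tendsto_two_inv_pow_mul {X : ℝ≥0∞} (hX : X ≠ ⊤) :
    Tendsto (fun N : ℕ => (2⁻¹ : ℝ≥0∞) ^ N * X) atTop (𝓝 0) := by
  simpa using ENNReal.Tendsto.mul_const
    (ENNReal.tendsto_pow_atTop_nhds_zero_of_lt_one (r := 2⁻¹) (by simp)) (Or.inr hX)

/-- Iterating `x ≤ y + κ * x` shows that `x` is dominated by `∑ κ^{*m} * y`; boundedness of `x`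
makes the remainder `κ^{*N} * x` vanish in the limit. -/
theorem tsum_le_two_mul_of_le_add_conv {X : ℝ≥0∞} (hX : X ≠ ⊤) (hx : ∀ i, x i ≤ X)
    (hκ : ∑' k, κ k ≤ 2⁻¹) (hle : ∀ i, x i ≤ y i + conv κ x i) :
    ∑' i, x i ≤ 2 * ∑' i, y i := by
  rw [ENNReal.tsum_eq_iSup_sum]
  refine iSup_le fun F => ?_
  have hlim : Tendsto (fun N : ℕ => 2 * ∑' i, y i + 2⁻¹ ^ N * (F.card * X)) atTop
      (𝓝 (2 * ∑' i, y i)) := by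
    simpa using (tendsto_two_inv_pow_mul
      (ENNReal.mul_ne_top (ENNReal.natCast_ne_top F.card) hX)).const_add (2 * ∑' i, y i)
  refine ge_of_tendsto' hlim fun N => ?_
  obtain ⟨s, hs, hxs⟩ := exists_le_add_two_inv_pow hx hκ hle N
  calc ∑ i ∈ F, x i ≤ ∑ i ∈ F, (s i + 2⁻¹ ^ N * X) := Finset.sum_le_sum fun i _ => hxs i
    _ = ∑ i ∈ F, s i + 2⁻¹ ^ N * (F.card * X) := by
        rw [Finset.sum_add_distrib, Finset.sum_const, nsmul_eq_mul]
        ring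
    _ ≤ 2 * ∑' i, y i + 2⁻¹ ^ N * (F.card * X) := by
        gcongr
        exact (ENNReal.sum_le_tsum F).trans hs

theorem tail_two_pow_mul_le {I : ℕ} {D δ : ℝ≥0∞} (hD : ∑' i, x i ≤ D)
    (h : ∀ J, I ≤ J → tail x (2 * J) ≤ 2⁻¹ * tail x J + 2⁻¹ * δ) (n : ℕ) :
    tail x (2 ^ n * I) ≤ 2⁻¹ ^ n * D + δ := by
  induction n with
  | zero => simpa using le_add_right ((tail_le_tsum x I).trans hD)
  | succ n ih =>
    calc tail x (2 ^ (n + 1) * I) = tail x (2 * (2 ^ n * I)) := by ring_nf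
      _ ≤ 2⁻¹ * tail x (2 ^ n * I) + 2⁻¹ * δ :=
          h _ (Nat.le_mul_of_pos_left _ (by positivity))
      _ ≤ 2⁻¹ * (2⁻¹ ^ n * D + δ) + 2⁻¹ * δ := by gcongr
      _ = 2⁻¹ ^ (n + 1) * D + (2⁻¹ + 2⁻¹) * δ := by ring
      _ = 2⁻¹ ^ (n + 1) * D + δ := by rw [ENNReal.inv_two_add_inv_two, one_mul]

theorem tail_two_mul_le (hκ : ∑' k, κ k ≤ 2⁻¹) (hle : ∀ i, x i ≤ y i + conv κ x i) (J : ℕ) :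
    tail x (2 * J) ≤ 2⁻¹ * tail x J + (tail y J + tail κ J * ∑' i, x i) := by
  calc tail x (2 * J) ≤ tail y (2 * J) + tail (conv κ x) (J + J) := by
        rw [← two_mul J, tail, tail, tail, ← ENNReal.tsum_add]
        exact ENNReal.tsum_le_tsum fun i => hle i
    _ ≤ tail y J + ((∑' k, κ k) * tail x J + tail κ J * ∑' i, x i) :=
        add_le_add (tail_anti y (by omega)) (tail_conv_le κ x J J)
    _ ≤ tail y J + (2⁻¹ * tail x J + tail κ J * ∑' i, x i) := by gcongr
    _ = 2⁻¹ * tail x J + (tail y J + tail κ J * ∑' i, x i) := by ring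

theorem UniformlySummable.of_le_add_conv {Ω : Type*} {l : Filter Ω} {κ x y : Ω → ℤ → ℝ≥0∞}
    (hκ : UniformlySummable l κ) (hκ_le : ∀ᶠ ω in l, ∑' k, κ ω k ≤ 2⁻¹)
    (hy : UniformlySummable l y) (hx : ∀ᶠ ω in l, ∃ X ≠ ⊤, ∀ i, x ω i ≤ X)
    (hle : ∀ᶠ ω in l, ∀ i, x ω i ≤ y ω i + conv (κ ω) (x ω) i) : UniformlySummable l x := by
  obtain ⟨C, hC, hyC⟩ := hy.1
  have hsum : ∀ᶠ ω in l, ∑' i, x ω i ≤ 2 * C := by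
    filter_upwards [hκ_le, hx, hle, hyC] with ω hκω ⟨X, hX, hxω⟩ hleω hyω
    exact (tsum_le_two_mul_of_le_add_conv hX hxω hκω hleω).trans (mul_le_mul_right hyω 2)
  have hD : 2 * C ≠ ⊤ := ENNReal.mul_ne_top (by simp) hC
  refine ⟨⟨2 * C, hD, hsum⟩, fun ε hε => ?_⟩
  obtain ⟨δ, hδ, hδε⟩ := exists_ne_zero_mul_le (c := 2) (by simp) hε
  obtain ⟨η, hη, hηδ⟩ := exists_ne_zero_mul_le (c := 1 + 2 * C) (δ := 2⁻¹ * δ)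
    (ENNReal.add_ne_top.2 ⟨ENNReal.one_ne_top, hD⟩) (mul_ne_zero (by simp) hδ)
  obtain ⟨K, hK⟩ := hκ.2 η hη
  obtain ⟨K', hK'⟩ := hy.2 η hη
  obtain ⟨n, hn⟩ := ((tendsto_two_inv_pow_mul hD).eventually_le_const
    (pos_iff_ne_zero.2 hδ)).exists
  refine ⟨2 ^ n * max K K', ?_⟩
  filter_upwards [hκ_le, hle, hsum, hK, hK'] with ω hκω hleω hsumω hKω hKω'
  have hstep : ∀ J, max K K' ≤ J → tail (x ω) (2 * J) ≤ 2⁻¹ * tail (x ω) J + 2⁻¹ * δ := by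
    intro J hJ
    refine (tail_two_mul_le hκω hleω J).trans (add_le_add le_rfl ?_)
    calc tail (y ω) J + tail (κ ω) J * ∑' i, x ω i ≤ η + η * (2 * C) := by
          gcongr
          · exact (tail_anti _ (le_of_max_le_right hJ)).trans hKω'
          · exact (tail_anti _ (le_of_max_le_left hJ)).trans hKω
      _ = (1 + 2 * C) * η := by ring
      _ ≤ 2⁻¹ * δ := hηδ
  calc tail (x ω) (2 ^ n * max K K') ≤ 2⁻¹ ^ n * (2 * C) + δ :=
        tail_two_pow_mul_le hsumω hstep n
    _ ≤ δ + δ := by gcongr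
    _ = 2 * δ := (two_mul δ).symm
    _ ≤ ε := hδε

end Convolution

/-! ### Localization at scale `L` -/

section Blocks

/-- The integers at distance less than `r * L` from the multiple `i * L`. -/
def window (L r : ℕ) (i : ℤ) : Set ℤ := {k | |k - i * L| < r * L}

/-- The sums of `u` over the overlapping windows of radius `r * L` around the multiples of `L`. -/
def blockSum (L r : ℕ) (u : ℤ → ℝ≥0∞) (i : ℤ) : ℝ≥0∞ := ∑' k, (window L r i).indicator u k

variable {L : ℕ}

theorem encard_mem_window_le (hL : 0 < L) (r : ℕ) (k : ℤ) :
    {i | k ∈ window L r i}.encard ≤ (2 * r : ℕ) := by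
  have hdiv := Int.mul_ediv_add_emod k L
  have hmod := Int.emod_nonneg k (b := L) (by omega)
  have hmod_lt := Int.emod_lt_of_pos k (b := (L : ℤ)) (by omega)
  have hsub : {i | k ∈ window L r i} ⊆ ↑(Finset.Icc (k / L - r + 1) (k / L + r)) := by
    intro i hi
    obtain ⟨hlo, hhi⟩ := abs_lt.1 (show |k - i * L| < r * L from hi)
    rw [Finset.coe_Icc, Set.mem_Icc]
    constructor <;> by_contra! <;> nlinarith
  refine (Set.encard_le_encard hsub).trans ?_
  rw [Set.encard_coe_eq_coe_finsetCard, Int.card_Icc]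
  exact_mod_cast (by omega)

theorem encard_window_le (L r : ℕ) (i : ℤ) : (window L r i).encard ≤ (2 * (r * L) : ℕ) := by
  have hsub : window L r i ⊆ ↑(Finset.Ioo (i * L - r * L : ℤ) (i * L + r * L)) := by
    intro k hk
    obtain ⟨hlo, hhi⟩ := abs_lt.1 (show |k - i * L| < r * L from hk)
    rw [Finset.coe_Ioo, Set.mem_Ioo]
    constructor <;> linarith
  refine (Set.encard_le_encard hsub).trans ?_
  rw [Set.encard_coe_eq_coe_finsetCard, Int.card_Ioo]
  norm_cast
  omega

theorem tsum_blockSum_le (hL : 0 < L) (r : ℕ) (u : ℤ → ℝ≥0∞) :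
    ∑' i, blockSum L r u i ≤ (2 * r : ℕ) * ∑' k, u k :=
  tsum_tsum_indicator_le (P := fun i k => k ∈ window L r i) (encard_mem_window_le hL r) u

variable {Ω : Type*} {l : Filter Ω} {a : Ω → ℤ → ℝ≥0∞}

theorem UniformlySummable.blockSum (ha : UniformlySummable l a) (hL : 0 < L) (r : ℕ) :
    UniformlySummable l fun ω => blockSum L r (a ω) := by
  refine ha.tsum_related (P := fun i k => k ∈ window L r i) (encard_mem_window_le hL r)
    fun K => ⟨K + r, fun i k hk hi => ?_⟩
  have hk' : |k - i * L| < r * L := hk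
  have htri := abs_sub_abs_le_abs_sub (i * L) k
  rw [abs_sub_comm, abs_mul, Nat.abs_cast] at htri
  push_cast at hi
  nlinarith

theorem UniformlySummable.comp_ediv (ha : UniformlySummable l a) (hL : 0 < L) :
    UniformlySummable l fun ω j => a ω (j / L) := by
  have hL' : (0 : ℤ) < L := by exact_mod_cast hL
  have hcard : ∀ i : ℤ, {j : ℤ | i = j / L}.encard ≤ L := by
    intro i
    have hsub : {j : ℤ | i = j / L} ⊆ ↑(Finset.Ico (i * L : ℤ) (i * L + L)) := by
      rintro j rfl
      rw [Finset.coe_Ico, Set.mem_Ico]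
      have hdiv := Int.mul_ediv_add_emod j L
      have hmod := Int.emod_nonneg j hL'.ne'
      have hmod_lt := Int.emod_lt_of_pos j hL'
      constructor <;> linarith
    refine (Set.encard_le_encard hsub).trans ?_
    rw [Set.encard_coe_eq_coe_finsetCard, Int.card_Ico]
    norm_cast
    omega
  refine (ha.tsum_related (P := fun j i => i = j / L) hcard
    fun K => ⟨L * (K + 1), ?_⟩).mono (Eventually.of_forall fun ω j => ?_)
  · rintro j i rfl hj
    have hdiv := Int.mul_ediv_add_emod j L
    have hmod := Int.emod_nonneg j hL'.ne'
    have hmod_lt := Int.emod_lt_of_pos j hL'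
    have htri := abs_add_le (L * (j / (L : ℤ))) (j % L)
    rw [hdiv, abs_mul, Nat.abs_cast, abs_of_nonneg hmod] at htri
    push_cast at hj
    nlinarith
  · refine le_trans ?_ (ENNReal.le_tsum (j / (L : ℤ)))
    rw [Set.indicator_of_mem (by rfl)]

end Blocks

section Localization

theorem tsum_mul_le_sqrt_mul_sqrt {ι : Type*} (u v : ι → ℝ≥0∞) :
    ∑' i, u i * v i ≤ (∑' i, u i ^ 2) ^ (1 / 2 : ℝ) * (∑' i, v i ^ 2) ^ (1 / 2 : ℝ) := by
  let _ : MeasurableSpace ι := ⊤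
  have h := ENNReal.lintegral_mul_le_Lp_mul_Lq (Measure.count : Measure ι)
    (p := 2) (q := 2) ⟨by norm_num, by norm_num, by norm_num⟩ (f := u) (g := v)
    measurable_from_top.aemeasurable measurable_from_top.aemeasurable
  simpa [lintegral_count] using h

theorem sqrt_tsum_sq_le_tsum {ι : Type*} (u : ι → ℝ≥0∞) :
    (∑' i, u i ^ 2) ^ (1 / 2 : ℝ) ≤ ∑' i, u i := by
  have hsq : ∑' i, u i ^ 2 ≤ (∑' i, u i) ^ 2 := by
    rw [sq (∑' i, u i), ← ENNReal.tsum_mul_right]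
    refine ENNReal.tsum_le_tsum fun i => ?_
    rw [sq]
    gcongr
    exact ENNReal.le_tsum i
  calc (∑' i, u i ^ 2) ^ (1 / 2 : ℝ) ≤ ((∑' i, u i) ^ 2) ^ (1 / 2 : ℝ) := by gcongr
    _ = ∑' i, u i := by
        rw [← ENNReal.rpow_natCast, ← ENNReal.rpow_mul]
        norm_num

/-- The piecewise linear cutoff function that is `1` on `[-1, 1]` and `0` off `[-2, 2]`. -/
def plateau (s : ℝ) : ℝ := max 0 (min 1 (2 - |s|))

theorem plateau_nonneg (s : ℝ) : 0 ≤ plateau s := le_max_left _ _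

theorem plateau_le_one (s : ℝ) : plateau s ≤ 1 := max_le zero_le_one (min_le_left _ _)

theorem plateau_eq_one {s : ℝ} (hs : |s| ≤ 1) : plateau s = 1 := by
  rw [plateau, min_eq_left (by linarith), max_eq_right zero_le_one]

theorem plateau_eq_zero {s : ℝ} (hs : 2 ≤ |s|) : plateau s = 0 :=
  max_eq_left ((min_le_right _ _).trans (by linarith))

theorem abs_plateau_sub_le (s t : ℝ) : |plateau s - plateau t| ≤ |s - t| := by
  calc |plateau s - plateau t| ≤ |min 1 (2 - |s|) - min 1 (2 - |t|)| := by
        simpa [plateau] using abs_max_sub_max_le_max 0 (min 1 (2 - |s|)) 0 (min 1 (2 - |t|))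
    _ ≤ |(2 - |s|) - (2 - |t|)| := by
        simpa using abs_min_sub_min_le_max 1 (2 - |s|) 1 (2 - |t|)
    _ = |(|s| - |t|)| := by rw [sub_sub_sub_cancel_left, abs_sub_comm]
    _ ≤ |s - t| := abs_abs_sub_abs_le_abs_sub s t

/-- The cutoff function at scale `L` centred at `i * L`. -/
def bump (L : ℕ) (i j : ℤ) : ℝ := plateau (j / L - i)

variable {L : ℕ}

theorem mem_window_of_bump_ne_zero (hL : 0 < L) {i j : ℤ} (h : bump L i j ≠ 0) :
    j ∈ window L 2 i := by
  have hL' : (0 : ℝ) < L := by exact_mod_cast hL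
  have hlt : |(j : ℝ) / L - i| < 2 := by
    by_contra! hge
    exact h (plateau_eq_zero hge)
  have hlt' : |(j : ℝ) - i * L| < 2 * L := by
    rw [show (j : ℝ) - i * L = (j / L - i) * L by field_simp, abs_mul, abs_of_pos hL']
    gcongr
  exact_mod_cast hlt'

theorem bump_ediv_eq_one (L : ℕ) (j : ℤ) : bump L (j / L) j = 1 := by
  have hfract : (j : ℝ) / L - (j / (L : ℤ) : ℤ) = Int.fract ((j : ℝ) / L) := by
    rw [Int.fract, Int.floor_div_natCast, Int.floor_intCast]
  refine plateau_eq_one ?_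
  rw [hfract, abs_of_nonneg (Int.fract_nonneg _)]
  exact (Int.fract_lt_one _).le

theorem abs_bump_sub_le (L : ℕ) (i j k : ℤ) :
    |bump L i j - bump L i k| ≤ min 1 (|((j - k : ℤ) : ℝ)| / L) := by
  refine le_min ?_ ?_
  · rw [abs_le]
    unfold bump
    constructor <;> linarith [plateau_nonneg (j / L - i), plateau_le_one (j / L - i),
      plateau_nonneg (k / L - i), plateau_le_one (k / L - i)]
  · refine (abs_plateau_sub_le _ _).trans_eq ?_
    rw [show (j : ℝ) / L - i - (k / L - i) = ((j - k : ℤ) : ℝ) / L by push_cast; ring, abs_div,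
      Nat.abs_cast]

theorem enorm_bump_mul_le (L : ℕ) (F : ℤ → ℂ) (i j : ℤ) : ‖(bump L i j : ℂ) * F j‖ₑ ≤ ‖F j‖ₑ := by
  rw [enorm_mul, ← ofReal_norm, Complex.norm_real, bump,
    Real.norm_of_nonneg (plateau_nonneg _)]
  exact mul_le_of_le_one_left zero_le (ENNReal.ofReal_le_one.2 (plateau_le_one _))

/-- The `ℓ²`-norm of `F` localized by the cutoff function `bump L i`. -/
def locNorm (L : ℕ) (F : ℤ → ℂ) (i : ℤ) : ℝ≥0∞ :=
  (∑' j, ‖(bump L i j : ℂ) * F j‖ₑ ^ 2) ^ (1 / 2 : ℝ)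

theorem locNorm_sq (L : ℕ) (F : ℤ → ℂ) (i : ℤ) :
    locNorm L F i ^ 2 = ∑' j, ‖(bump L i j : ℂ) * F j‖ₑ ^ 2 := by
  rw [locNorm, ← ENNReal.rpow_natCast, ← ENNReal.rpow_mul]
  norm_num

theorem enorm_le_locNorm (L : ℕ) (F : ℤ → ℂ) (j : ℤ) : ‖F j‖ₑ ≤ locNorm L F (j / L) := by
  rw [← ENNReal.pow_le_pow_left_iff two_ne_zero, locNorm_sq]
  refine le_trans ?_ (ENNReal.le_tsum j)
  rw [bump_ediv_eq_one L j, Complex.ofReal_one, one_mul]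

theorem locNorm_le_blockSum (hL : 0 < L) (F : ℤ → ℂ) (i : ℤ) :
    locNorm L F i ≤ blockSum L 2 (fun j => ‖F j‖ₑ) i := by
  refine (sqrt_tsum_sq_le_tsum _).trans (ENNReal.tsum_le_tsum fun j => ?_)
  by_cases hj : bump L i j = 0
  · simp only [hj, Complex.ofReal_zero, zero_mul, enorm_zero, zero_le]
  · rw [Set.indicator_of_mem (mem_window_of_bump_ne_zero hL hj)]
    exact enorm_bump_mul_le L F i j

theorem locNorm_le_of_enorm_le (hL : 0 < L) {F : ℤ → ℂ} {C : ℝ≥0∞} (hF : ∀ j, ‖F j‖ₑ ≤ C)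
    (i : ℤ) : locNorm L F i ≤ (2 * (2 * L) : ℕ) * C := by
  calc locNorm L F i ≤ ∑' j, (window L 2 i).indicator (fun _ => C) j :=
        (locNorm_le_blockSum hL F i).trans
          (ENNReal.tsum_le_tsum fun j => Set.indicator_le_indicator (hF j))
    _ = (window L 2 i).encard * C := by rw [← tsum_subtype, ENNReal.tsum_const, Set.encard]
    _ ≤ (2 * (2 * L) : ℕ) * C := by
        gcongr
        exact_mod_cast encard_window_le L 2 i

/-- The weights `a k * min 1 (|k| / L)` summed over windows: they control the commutators of a
matrix with entries dominated by `a (j - l)` with the cutoff functions at scale `L`. -/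
def commKernel (L : ℕ) (a : ℤ → ℝ≥0∞) : ℤ → ℝ≥0∞ :=
  blockSum L 4 fun k => a k * ENNReal.ofReal (min 1 (|(k : ℝ)| / L))

theorem UniformlySummable.commKernel {Ω : Type*} {l : Filter Ω} {a : Ω → ℤ → ℝ≥0∞}
    (ha : UniformlySummable l a) (hL : 0 < L) :
    UniformlySummable l fun ω => commKernel L (a ω) :=
  (ha.mono (Eventually.of_forall fun _ _ => mul_le_of_le_one_right zero_le
    (ENNReal.ofReal_le_one.2 (min_le_left _ _)))).blockSum hL 4

theorem tsum_mul_min_le (L : ℕ) (a : ℤ → ℝ≥0∞) (N : ℕ) :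
    ∑' k : ℤ, a k * ENNReal.ofReal (min 1 (|(k : ℝ)| / L)) ≤
      ENNReal.ofReal (N / L) * ∑' k, a k + tail a N := by
  rw [← ENNReal.tsum_mul_left, tail_eq_tsum_indicator, ← ENNReal.tsum_add]
  refine ENNReal.tsum_le_tsum fun k => ?_
  by_cases hk : (N : ℤ) ≤ |k|
  · rw [Set.indicator_of_mem (show k ∈ {k : ℤ | (N : ℤ) ≤ |k|} from hk)]
    exact le_add_left
      (mul_le_of_le_one_right zero_le (ENNReal.ofReal_le_one.2 (min_le_left _ _)))
  · refine le_add_right ?_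
    rw [mul_comm]
    gcongr
    refine (min_le_right _ _).trans ?_
    gcongr
    exact_mod_cast (not_le.1 hk).le

theorem exists_tsum_commKernel_le {Ω : Type*} {l : Filter Ω} {a : Ω → ℤ → ℝ≥0∞}
    (ha : UniformlySummable l a) {δ : ℝ≥0∞} (hδ : δ ≠ 0) :
    ∃ L : ℕ, 0 < L ∧ ∀ᶠ ω in l, ∑' k, commKernel L (a ω) k ≤ δ := by
  obtain ⟨C, hC, haC⟩ := ha.1
  obtain ⟨η, hη, hηδ⟩ := exists_ne_zero_mul_le (c := 16) (by simp) hδ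
  obtain ⟨N, hN⟩ := ha.2 η hη
  have hlim : Tendsto (fun L : ℕ => ENNReal.ofReal (N / L) * C) atTop (𝓝 0) := by
    simpa using ENNReal.Tendsto.mul_const
      (ENNReal.tendsto_ofReal (tendsto_const_div_atTop_nhds_zero_nat (N : ℝ))) (Or.inr hC)
  obtain ⟨L, hLη, hL⟩ := ((hlim.eventually_le_const (pos_iff_ne_zero.2 hη)).and
    (eventually_gt_atTop 0)).exists
  refine ⟨L, hL, ?_⟩
  filter_upwards [haC, hN] with ω haω hNω
  calc ∑' k, commKernel L (a ω) k
      ≤ (2 * 4 : ℕ) * (ENNReal.ofReal (N / L) * ∑' k, a ω k + tail (a ω) N) :=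
        (tsum_blockSum_le hL 4 _).trans (mul_le_mul_right (tsum_mul_min_le L _ N) _)
    _ ≤ (2 * 4 : ℕ) * (η + η) := by
        gcongr
        exact (mul_le_mul_right haω _).trans hLη
    _ = 16 * η := by
        norm_num
        ring
    _ ≤ δ := hηδ

theorem bump_mul_le_tsum_indicator (hL : 0 < L) (a : ℤ → ℝ≥0∞) (F : ℤ → ℂ) (i j k : ℤ) :
    ‖(bump L i j : ℂ) * F j‖ₑ *
        (a (j - k) * ENNReal.ofReal |bump L i j - bump L i k| * ‖F k‖ₑ) ≤
      ∑' i', (window L 4 (i - i')).indicator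
          (fun m => a m * ENNReal.ofReal (min 1 (|(m : ℝ)| / L))) (j - k) *
        (‖(bump L i j : ℂ) * F j‖ₑ * ‖(bump L i' k : ℂ) * F k‖ₑ) := by
  by_cases hj : bump L i j = 0
  · simp only [hj, Complex.ofReal_zero, zero_mul, enorm_zero, zero_le]
  have hk : bump L (k / L) k = 1 := bump_ediv_eq_one L k
  have hwin : j - k ∈ window L 4 (i - k / L) := by
    have hj' : |j - i * L| < 2 * L := mem_window_of_bump_ne_zero hL hj
    have hk' : |k - k / L * L| < 2 * L := mem_window_of_bump_ne_zero hL (hk ▸ one_ne_zero)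
    change |j - k - (i - k / L) * L| < 4 * L
    rw [show j - k - (i - k / L) * L = (j - i * L) - (k - k / L * L) by ring]
    exact (abs_sub _ _).trans_lt (by linarith)
  refine le_trans ?_ (ENNReal.le_tsum (k / (L : ℤ)))
  rw [Set.indicator_of_mem hwin, hk, Complex.ofReal_one, one_mul, mul_left_comm, mul_assoc,
    mul_assoc]
  gcongr
  exact abs_bump_sub_le L i j k

theorem tsum_bump_mul_le (hL : 0 < L) (a : ℤ → ℝ≥0∞) (F : ℤ → ℂ) (i : ℤ) :
    ∑' j, ∑' k, ‖(bump L i j : ℂ) * F j‖ₑ *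
        (a (j - k) * ENNReal.ofReal |bump L i j - bump L i k| * ‖F k‖ₑ) ≤
      locNorm L F i * conv (commKernel L a) (locNorm L F) i := by
  set u : ℤ → ℤ → ℝ≥0∞ := fun i j => ‖(bump L i j : ℂ) * F j‖ₑ
  set w : ℤ → ℤ → ℝ≥0∞ := fun i => (window L 4 i).indicator
    fun m => a m * ENNReal.ofReal (min 1 (|(m : ℝ)| / L))
  have hcross : ∀ i' m, ∑' j, u i j * u i' (j - m) ≤ locNorm L F i * locNorm L F i' := by
    intro i' m
    refine (tsum_mul_le_sqrt_mul_sqrt _ _).trans_eq ?_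
    congr 2
    exact (Equiv.subRight m).tsum_eq fun j => u i' j ^ 2
  calc _ ≤ ∑' j, ∑' k, ∑' i', w (i - i') (j - k) * (u i j * u i' k) :=
        ENNReal.tsum_le_tsum fun j => ENNReal.tsum_le_tsum fun k =>
          bump_mul_le_tsum_indicator hL a F i j k
    _ = ∑' j, ∑' m, ∑' i', w (i - i') m * (u i j * u i' (j - m)) := by
        refine tsum_congr fun j => ?_
        rw [← (Equiv.subLeft j).tsum_eq]
        simp only [Equiv.subLeft_apply, sub_sub_cancel]
    _ = ∑' i', ∑' m, ∑' j, w (i - i') m * (u i j * u i' (j - m)) := by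
        rw [ENNReal.tsum_comm]
        conv_rhs => rw [ENNReal.tsum_comm]
        exact tsum_congr fun m => ENNReal.tsum_comm
    _ ≤ ∑' i', ∑' m, w (i - i') m * (locNorm L F i * locNorm L F i') := by
        refine ENNReal.tsum_le_tsum fun i' => ENNReal.tsum_le_tsum fun m => ?_
        rw [ENNReal.tsum_mul_left]
        gcongr
        exact hcross i' m
    _ = locNorm L F i * conv (commKernel L a) (locNorm L F) i := by
        rw [conv, ← ENNReal.tsum_mul_left]
        refine tsum_congr fun i' => ?_
        rw [ENNReal.tsum_mul_right, mul_left_comm]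
        rfl

end Localization

/-! ### Wiener's lemma, uniformly over a family of matrices -/

section Wiener

/-- The sesquilinear form of the matrix `M` on the vector `c` supported in `s`. -/
def hermForm {ι : Type*} (M : ι → ι → ℂ) (s : Finset ι) (c : ι → ℂ) : ℂ :=
  ∑ j ∈ s, ∑ k ∈ s, starRingEnd ℂ (c j) * M j k * c k

/-- The form of `M` is bounded below by `α` on finitely supported vectors. -/
def CoerciveWith {ι : Type*} (α : ℝ) (M : ι → ι → ℂ) : Prop :=
  ∀ (s : Finset ι) (c : ι → ℂ), α * ∑ j ∈ s, ‖c j‖ ^ 2 ≤ (hermForm M s c).re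

theorem CoerciveWith.mul_sum_sq_le {ι : Type*} {α : ℝ} {M : ι → ι → ℂ} (hM : CoerciveWith α M)
    (s : Finset ι) (c : ι → ℂ) :
    ENNReal.ofReal α * ∑ j ∈ s, ‖c j‖ₑ ^ 2 ≤ ∑ j ∈ s, ‖c j‖ₑ * ‖∑ k ∈ s, M j k * c k‖ₑ := by
  have hreal : α * ∑ j ∈ s, ‖c j‖ ^ 2 ≤ ∑ j ∈ s, ‖c j‖ * ‖∑ k ∈ s, M j k * c k‖ := by
    refine (hM s c).trans ((Complex.re_le_norm _).trans ((norm_sum_le _ _).trans ?_))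
    refine Finset.sum_le_sum fun j _ => ?_
    rw [← RCLike.norm_conj (c j), ← norm_mul, Finset.mul_sum]
    simp only [mul_assoc, le_refl]
  have henorm := ENNReal.ofReal_le_ofReal hreal
  rw [ENNReal.ofReal_mul' (by positivity), ENNReal.ofReal_sum_of_nonneg (fun _ _ => by positivity),
    ENNReal.ofReal_sum_of_nonneg (fun _ _ => by positivity)] at henorm
  simpa only [ENNReal.ofReal_mul (norm_nonneg _), ENNReal.ofReal_pow (norm_nonneg _),
    ofReal_norm] using henorm

variable {M : ℤ → ℤ → ℂ} {a : ℤ → ℝ≥0∞} {F R : ℤ → ℂ} {α : ℝ} {L : ℕ}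

/-- `M (φ F) = φ R - [φ, M] F` for `R = M F` and a cutoff function `φ`. -/
theorem enorm_sum_mul_bump_le (hMa : ∀ j k, ‖M j k‖ₑ ≤ a (j - k))
    (hMF : ∀ j, HasSum (fun k => M j k * F k) (R j)) {i : ℤ} {s : Finset ℤ}
    (hs : ∀ k ∉ s, bump L i k = 0) (j : ℤ) :
    ‖∑ k ∈ s, M j k * ((bump L i k : ℂ) * F k)‖ₑ ≤ ‖(bump L i j : ℂ) * R j‖ₑ +
      ∑' k, a (j - k) * ENNReal.ofReal |bump L i j - bump L i k| * ‖F k‖ₑ := by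
  have hlocal : HasSum (fun k => M j k * ((bump L i k : ℂ) * F k))
      (∑ k ∈ s, M j k * ((bump L i k : ℂ) * F k)) :=
    hasSum_sum_of_ne_finset_zero fun k hk => by simp [hs k hk]
  have hcomm := hlocal.sub ((hMF j).mul_left (bump L i j : ℂ))
  calc ‖∑ k ∈ s, M j k * ((bump L i k : ℂ) * F k)‖ₑ
      ≤ ‖(bump L i j : ℂ) * R j‖ₑ + ‖∑ k ∈ s, M j k * ((bump L i k : ℂ) * F k) -
          (bump L i j : ℂ) * R j‖ₑ := by
        refine le_of_eq_of_le ?_ (enorm_add_le _ _)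
        rw [add_sub_cancel]
    _ ≤ _ := by
        rw [← hcomm.tsum_eq]
        gcongr
        refine enorm_tsum_le_tsum_enorm.trans (ENNReal.tsum_le_tsum fun k => ?_)
        rw [show M j k * ((bump L i k : ℂ) * F k) - (bump L i j : ℂ) * (M j k * F k) =
          M j k * ((bump L i k - bump L i j : ℝ) : ℂ) * F k by push_cast; ring, enorm_mul,
          enorm_mul, ← ofReal_norm ((bump L i k - bump L i j : ℝ) : ℂ), Complex.norm_real,
          Real.norm_eq_abs, abs_sub_comm]
        gcongr
        exact hMa j k

theorem mul_locNorm_le (hL : 0 < L) (hMa : ∀ j k, ‖M j k‖ₑ ≤ a (j - k)) (hM : CoerciveWith α M)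
    {C : ℝ≥0∞} (hC : C ≠ ⊤) (hF : ∀ j, ‖F j‖ₑ ≤ C)
    (hMF : ∀ j, HasSum (fun k => M j k * F k) (R j)) (i : ℤ) :
    ENNReal.ofReal α * locNorm L F i ≤ locNorm L R i + conv (commKernel L a) (locNorm L F) i := by
  have hfin : locNorm L F i ≠ ⊤ := ne_top_of_le_ne_top
    (ENNReal.mul_ne_top (ENNReal.natCast_ne_top _) hC) (locNorm_le_of_enorm_le hL hF i)
  have hsupp : (window L 2 i).Finite :=
    Set.finite_of_encard_le_coe (encard_window_le L 2 i)
  have hbump : ∀ k ∉ hsupp.toFinset, bump L i k = 0 := fun k hk => by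
    by_contra hne
    exact hk (hsupp.mem_toFinset.2 (mem_window_of_bump_ne_zero hL hne))
  set u : ℤ → ℝ≥0∞ := fun j => ‖(bump L i j : ℂ) * F j‖ₑ
  have hmul : locNorm L F i * (ENNReal.ofReal α * locNorm L F i) ≤
      locNorm L F i * (locNorm L R i + conv (commKernel L a) (locNorm L F) i) := by
    calc locNorm L F i * (ENNReal.ofReal α * locNorm L F i)
        = ENNReal.ofReal α * ∑ j ∈ hsupp.toFinset, u j ^ 2 := by
          rw [mul_left_comm, ← sq, locNorm_sq, tsum_eq_sum fun j hj => by simp [hbump j hj]]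
      _ ≤ ∑ j ∈ hsupp.toFinset,
            u j * ‖∑ k ∈ hsupp.toFinset, M j k * ((bump L i k : ℂ) * F k)‖ₑ :=
          hM.mul_sum_sq_le _ _
      _ ≤ ∑' j, u j * (‖(bump L i j : ℂ) * R j‖ₑ +
            ∑' k, a (j - k) * ENNReal.ofReal |bump L i j - bump L i k| * ‖F k‖ₑ) := by
          refine le_trans (Finset.sum_le_sum fun j _ => ?_) (ENNReal.sum_le_tsum _)
          gcongr
          exact enorm_sum_mul_bump_le hMa hMF hbump j
      _ ≤ _ := by
          simp only [mul_add, ENNReal.tsum_add, ← ENNReal.tsum_mul_left]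
          exact add_le_add (tsum_mul_le_sqrt_mul_sqrt _ _) (tsum_bump_mul_le hL a F i)
  by_cases h0 : locNorm L F i = 0
  · simp only [h0, mul_zero, zero_le]
  · exact (ENNReal.mul_le_mul_iff_right h0 hfin).1 hmul

/-- Coercivity turns the localized equations into `locNorm F ≤ α⁻¹ (locNorm R + κ * locNorm F)`,
and the commutator kernel `κ` is a contraction once the scale `L` is large. -/
theorem uniformlySummable_enorm_of_coerciveWith {Ω : Type*} {l : Filter Ω} {M : Ω → ℤ → ℤ → ℂ}
    {a : Ω → ℤ → ℝ≥0∞} {F R : Ω → ℤ → ℂ} (hα : 0 < α) (ha : UniformlySummable l a)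
    (hMa : ∀ᶠ ω in l, ∀ j k, ‖M ω j k‖ₑ ≤ a ω (j - k)) (hM : ∀ᶠ ω in l, CoerciveWith α (M ω))
    (hF : ∀ᶠ ω in l, ∃ C ≠ ⊤, ∀ j, ‖F ω j‖ₑ ≤ C)
    (hR : UniformlySummable l fun ω j => ‖R ω j‖ₑ)
    (hMF : ∀ᶠ ω in l, ∀ j, HasSum (fun k => M ω j k * F ω k) (R ω j)) :
    UniformlySummable l fun ω j => ‖F ω j‖ₑ := by
  set β := ENNReal.ofReal α
  have hβ0 : β ≠ 0 := (ENNReal.ofReal_pos.2 hα).ne'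
  have hβinv : β⁻¹ ≠ ⊤ := ENNReal.inv_ne_top.2 hβ0
  have hcancel : β⁻¹ * β = 1 := ENNReal.inv_mul_cancel hβ0 ENNReal.ofReal_ne_top
  obtain ⟨L, hL, hκ⟩ := exists_tsum_commKernel_le ha (δ := β * 2⁻¹) (mul_ne_zero hβ0 (by simp))
  have hlocal : UniformlySummable l fun ω => locNorm L (F ω) := by
    refine ((ha.commKernel hL).const_mul hβinv).of_le_add_conv ?_
      ((hR.blockSum hL 2).const_mul hβinv) ?_ ?_
    · filter_upwards [hκ] with ω hκω
      rw [ENNReal.tsum_mul_left]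
      refine (mul_le_mul_right hκω β⁻¹).trans_eq ?_
      rw [← mul_assoc, hcancel, one_mul]
    · filter_upwards [hF] with ω ⟨C, hC, hFC⟩
      exact ⟨_, ENNReal.mul_ne_top (ENNReal.natCast_ne_top _) hC, locNorm_le_of_enorm_le hL hFC⟩
    · filter_upwards [hMa, hM, hF, hMF] with ω hMaω hMω ⟨C, hC, hFC⟩ hMFω i
      rw [conv_const_mul, ← mul_add]
      calc locNorm L (F ω) i = β⁻¹ * (β * locNorm L (F ω) i) := by
            rw [← mul_assoc, hcancel, one_mul]
        _ ≤ β⁻¹ * (locNorm L (R ω) i + conv (commKernel L (a ω)) (locNorm L (F ω)) i) :=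
            mul_le_mul_right (mul_locNorm_le hL hMaω hMω hC hFC hMFω i) _
        _ ≤ _ := by
            gcongr
            exact locNorm_le_blockSum hL (R ω) i
  exact (hlocal.comp_ediv hL).mono
    (Eventually.of_forall fun ω j => enorm_le_locNorm L (F ω) j)

end Wiener

/-! ### The canonical dual of a frame -/

section FrameOperators

variable {ι H : Type*} [NormedAddCommGroup H] [InnerProductSpace ℂ H]

theorem inner_sum_smul_map_sum_smul (S : H →L[ℂ] H) (v : ι → H) (s : Finset ι) (c : ι → ℂ) :
    inner ℂ (∑ j ∈ s, c j • v j) (S (∑ j ∈ s, c j • v j)) =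
      hermForm (fun j k => inner ℂ (v j) (S (v k))) s c := by
  rw [hermForm, sum_inner]
  refine Finset.sum_congr rfl fun j _ => ?_
  rw [map_sum, inner_sum]
  refine Finset.sum_congr rfl fun k _ => ?_
  rw [map_smul, inner_smul_left, inner_smul_right]
  ring

variable [CompleteSpace H] {φ : ι → H}

theorem HasUpperFrameBound.exists_clm_eq (h : HasUpperFrameBound φ) :
    ∃ S : H →L[ℂ] H, ⇑S = frameOperator φ := by
  obtain ⟨S, hS⟩ := h.exists_clm
  exact ⟨S, funext fun f => (hS f).tsum_eq.symm⟩

theorem HasUpperFrameBound.hasSum_inner_frameOperator (h : HasUpperFrameBound φ) (f u : H) :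
    HasSum (fun i => inner ℂ (φ i) f * inner ℂ u (φ i)) (inner ℂ u (frameOperator φ f)) := by
  simpa only [innerSL_apply_apply, inner_smul_right] using
    (h.hasSum_frameOperator f).mapL (innerSL ℂ u)

theorem HasUpperFrameBound.inner_frameOperator_comm (h : HasUpperFrameBound φ) (f u : H) :
    inner ℂ (frameOperator φ u) f = inner ℂ u (frameOperator φ f) := by
  have hconj := (h.hasSum_inner_frameOperator u f).star
  rw [← inner_conj_symm]
  refine hconj.unique ((h.hasSum_inner_frameOperator f u).congr_fun fun i => ?_)
  simp [mul_comm]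

theorem HasUpperFrameBound.re_inner_frameOperator (h : HasUpperFrameBound φ) (f : H) :
    (inner ℂ f (frameOperator φ f)).re = ∑' i, ‖inner ℂ (φ i) f‖ ^ 2 := by
  rw [← (Complex.hasSum_re (h.hasSum_inner_frameOperator f f)).tsum_eq]
  refine tsum_congr fun i => ?_
  rw [← inner_conj_symm f (φ i), Complex.mul_conj', ← Complex.ofReal_pow, Complex.ofReal_re]

theorem IsFrame.frameOperator_symm (h : IsFrame φ) (f : H) :
    frameOperator φ (h.frameEquiv.symm f) = f :=
  h.frameEquiv.apply_symm_apply f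

theorem IsFrame.symm_frameOperator (h : IsFrame φ) (f : H) :
    h.frameEquiv.symm (frameOperator φ f) = f :=
  h.frameEquiv.symm_apply_apply f

theorem IsFrame.inner_symm (h : IsFrame φ) (f u : H) :
    inner ℂ (h.frameEquiv.symm u) f = inner ℂ u (h.frameEquiv.symm f) := by
  conv_lhs => rw [← h.frameOperator_symm f]
  rw [← h.hasUpperFrameBound.inner_frameOperator_comm, h.frameOperator_symm]

theorem IsFrame.exists_le_re_inner_frameOperator (h : IsFrame φ) :
    ∃ A > 0, ∀ f, A * ‖f‖ ^ 2 ≤ (inner ℂ f (frameOperator φ f)).re := by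
  have ⟨A, _, hA, _, hAB⟩ := h
  refine ⟨A, hA, fun f => ?_⟩
  rw [h.hasUpperFrameBound.re_inner_frameOperator]
  exact (hAB f).2.1

theorem IsFrame.exists_norm_symm_le (h : IsFrame φ) :
    ∃ C > 0, ∀ f, ‖h.frameEquiv.symm f‖ ≤ C * ‖f‖ := by
  obtain ⟨A, hA, hlow⟩ := h.exists_le_re_inner_frameOperator
  refine ⟨A⁻¹, inv_pos.2 hA, fun f => ?_⟩
  rw [inv_mul_eq_div, le_div_iff₀ hA]
  have hle : A * ‖h.frameEquiv.symm f‖ ^ 2 ≤ ‖h.frameEquiv.symm f‖ * ‖f‖ := by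
    have hsymm := hlow (h.frameEquiv.symm f)
    rw [h.frameOperator_symm] at hsymm
    exact hsymm.trans (re_inner_le_norm (𝕜 := ℂ) _ _)
  rcases (norm_nonneg (h.frameEquiv.symm f)).eq_or_lt with hzero | hpos
  · rw [← hzero, zero_mul]
    positivity
  · nlinarith

theorem IsFrame.hasUpperFrameBound_dual (h : IsFrame φ) :
    HasUpperFrameBound fun i => h.frameEquiv.symm (φ i) := by
  obtain ⟨B, hB, hφ⟩ := h.hasUpperFrameBound
  obtain ⟨C, hC, hnorm⟩ := h.exists_norm_symm_le
  refine ⟨B * C ^ 2, by positivity, fun f => ?_⟩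
  simp only [h.inner_symm]
  refine ⟨(hφ _).1, (hφ _).2.trans ?_⟩
  rw [mul_assoc, ← mul_pow]
  gcongr
  exact hnorm f

theorem IsFrame.frameOperator_dual (h : IsFrame φ) (f : H) :
    frameOperator (fun i => h.frameEquiv.symm (φ i)) f = h.frameEquiv.symm f := by
  obtain ⟨S, hS⟩ := h.hasUpperFrameBound.exists_clm_eq
  have hsum := (h.hasUpperFrameBound_dual.hasSum_frameOperator f).mapL S
  simp only [map_smul, hS, h.frameOperator_symm, h.inner_symm] at hsum
  rw [← h.symm_frameOperator (frameOperator _ f), ← hsum.tsum_eq]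
  exact congrArg _ (h.frameOperator_symm f)

theorem HasUpperFrameBound.frameOperator_comm (h : HasUpperFrameBound φ) (U : H →ₗᵢ[ℂ] H)
    (σ : ι ≃ ι) {c : ι → ℂ} (hc : ∀ i, ‖c i‖ = 1) (hU : ∀ i, φ (σ i) = c i • U (φ i)) (f : H) :
    frameOperator φ (U f) = U (frameOperator φ f) := by
  have hleft := σ.hasSum_iff.2 (h.hasSum_frameOperator (U f))
  have hright := (h.hasSum_frameOperator f).mapL U.toContinuousLinearMap
  refine hleft.unique (hright.congr_fun fun i => ?_)
  have hci : starRingEnd ℂ (c i) * c i = 1 := by simp [RCLike.conj_mul, hc]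
  simp only [Function.comp_apply, hU, LinearIsometry.coe_toContinuousLinearMap, map_smul,
    inner_smul_left, U.inner_map_map, smul_smul, mul_right_comm, hci, one_mul]

end FrameOperators

/-! ### Time-frequency shifts -/

section Shifts

open scoped FourierTransform

theorem exp_two_pi_I_mul (ω t : ℝ) :
    Complex.exp (2 * Real.pi * Complex.I * ω * t) = 𝐞 (ω * t) := by
  rw [Real.fourierChar_apply]
  congr 1
  push_cast
  ring

theorem coeFn_modTrans (ω x : ℝ) (g : L2R) :
    modTrans ω x g =ᵐ[volume] fun t : ℝ => 𝐞 (ω * t) * g (t - x) := by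
  simp only [← exp_two_pi_I_mul]
  exact MemLp.coeFn_toLp (memLp_translate_modulate x ω g)

theorem ae_sub {p : ℝ → Prop} (h : ∀ᵐ t, p t) (x : ℝ) : ∀ᵐ t, p (t - x) :=
  (eventually_sub_right_iff volume x).2 h

theorem ae_add {p : ℝ → Prop} (h : ∀ᵐ t, p t) (x : ℝ) : ∀ᵐ t, p (t + x) :=
  (eventually_add_right_iff volume x).2 h

theorem norm_modTrans (ω x : ℝ) (g : L2R) : ‖modTrans ω x g‖ = ‖g‖ := by
  rw [Lp.norm_def, Lp.norm_def, ← eLpNorm_comp_measurePreserving (Lp.aestronglyMeasurable g)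
    (measurePreserving_sub_right volume x)]
  refine congrArg _ (eLpNorm_congr_norm_ae ?_)
  filter_upwards [coeFn_modTrans ω x g] with t ht
  rw [ht, norm_mul, Circle.norm_coe, one_mul, Function.comp_apply]

/-- The time-frequency shift `modTrans ω x` as a linear isometry of `L²(ℝ)`. -/
def modTransₗᵢ (ω x : ℝ) : L2R →ₗᵢ[ℂ] L2R where
  toFun := modTrans ω x
  map_add' f g := by
    ext1
    filter_upwards [coeFn_modTrans ω x (f + g), coeFn_modTrans ω x f, coeFn_modTrans ω x g,
      Lp.coeFn_add (modTrans ω x f) (modTrans ω x g), ae_sub (Lp.coeFn_add f g) x]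
      with t hfg hf hg hsum hadd
    rw [hfg, hsum, Pi.add_apply, hf, hg, hadd, Pi.add_apply, mul_add]
  map_smul' c f := by
    ext1
    filter_upwards [coeFn_modTrans ω x (c • f), coeFn_modTrans ω x f,
      Lp.coeFn_smul c (modTrans ω x f), ae_sub (Lp.coeFn_smul c f) x] with t hcf hf hsmul hc
    rw [hcf, RingHom.id_apply, hsmul, Pi.smul_apply, hf, hc, Pi.smul_apply, smul_eq_mul,
      smul_eq_mul, mul_left_comm]
  norm_map' := norm_modTrans ω x

theorem modTrans_modTrans (ω ω' x x' : ℝ) (g : L2R) :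
    modTrans ω x (modTrans ω' x' g) =
      (𝐞 (-(ω' * x)) : ℂ) • modTrans (ω + ω') (x + x') g := by
  ext1
  filter_upwards [coeFn_modTrans ω x (modTrans ω' x' g), ae_sub (coeFn_modTrans ω' x' g) x,
    coeFn_modTrans (ω + ω') (x + x') g,
    Lp.coeFn_smul (𝐞 (-(ω' * x)) : ℂ) (modTrans (ω + ω') (x + x') g)] with t hout hin hadd hsmul
  have hphase : ω * t + ω' * (t - x) = -(ω' * x) + (ω + ω') * t := by ring
  rw [hout, hin, hsmul, Pi.smul_apply, hadd, smul_eq_mul, ← mul_assoc, ← mul_assoc,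
    ← Circle.coe_mul, ← Circle.coe_mul, ← AddChar.map_add_eq_mul, ← AddChar.map_add_eq_mul,
    sub_sub, hphase]

theorem whSystem_add (g : L2R) (a b : ℝ) (i : ℤ × ℤ) (m n : ℤ) :
    whSystem g a b (i + (m, n)) =
      (𝐞 (i.1 * b * (n * a)) : ℂ) • modTransₗᵢ (m * b) (n * a) (whSystem g a b i) := by
  have hcancel : (𝐞 (i.1 * b * (n * a)) : ℂ) * 𝐞 (-(i.1 * b * (n * a))) = 1 := by
    rw [← Circle.coe_mul, ← AddChar.map_add_eq_mul, add_neg_cancel, AddChar.map_zero_eq_one,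
      Circle.coe_one]
  change modTrans _ _ g = _ • modTrans _ _ (modTrans _ _ g)
  rw [modTrans_modTrans, smul_smul, hcancel, one_smul]
  congr 1 <;> push_cast [Prod.fst_add, Prod.snd_add] <;> ring

theorem frameOperator_modTrans {g : L2R} {a b : ℝ} (h : HasUpperFrameBound (whSystem g a b))
    (m n : ℤ) (f : L2R) :
    frameOperator (whSystem g a b) (modTrans (m * b) (n * a) f) =
      modTrans (m * b) (n * a) (frameOperator (whSystem g a b) f) :=
  h.frameOperator_comm (modTransₗᵢ (m * b) (n * a)) (Equiv.addRight (m, n))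
    (fun _ => Circle.norm_coe _) (fun i => whSystem_add g a b i m n) f

theorem whSystem_dual {g : L2R} {a b : ℝ} (hg : IsFrame (whSystem g a b)) :
    whSystem (hg.frameEquiv.symm g) a b = fun i => hg.frameEquiv.symm (whSystem g a b i) := by
  funext i
  rw [← hg.symm_frameOperator (whSystem (hg.frameEquiv.symm g) a b i), whSystem,
    frameOperator_modTrans hg.hasUpperFrameBound, hg.frameOperator_symm, whSystem]

end Shifts

/-! ### Periodization -/

section Periodization

section Series

variable {Ω ι E : Type*} [MeasurableSpace Ω] {μ : Measure Ω} [Countable ι] [NormedAddCommGroup E]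
  [CompleteSpace E] {F : ι → Ω → E}

theorem ae_summable_of_lintegral_tsum_enorm_ne_top (hF : ∀ i, AEStronglyMeasurable (F i) μ)
    (hfin : ∫⁻ t, ∑' i, ‖F i t‖ₑ ∂μ ≠ ⊤) : ∀ᵐ t ∂μ, Summable fun i => F i t := by
  filter_upwards [ae_lt_top' (AEMeasurable.tsum fun i => (hF i).enorm) hfin] with t ht
  exact (tsum_enorm_ne_top_iff_summable_norm.1 ht.ne).of_norm

theorem integrable_tsum_of_lintegral_tsum_enorm_ne_top
    (hF : ∀ i, AEStronglyMeasurable (F i) μ) (hfin : ∫⁻ t, ∑' i, ‖F i t‖ₑ ∂μ ≠ ⊤) :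
    Integrable (fun t => ∑' i, F i t) μ := by
  refine ⟨aestronglyMeasurable_of_tendsto_ae atTop
    (fun s => Finset.aestronglyMeasurable_fun_sum s fun i _ => hF i) ?_,
    (lintegral_mono fun t => enorm_tsum_le_tsum_enorm).trans_lt hfin.lt_top⟩
  exact (ae_summable_of_lintegral_tsum_enorm_ne_top hF hfin).mono fun t ht => ht.hasSum

theorem hasSum_integral_of_lintegral_tsum_enorm_ne_top [NormedSpace ℝ E]
    (hF : ∀ i, AEStronglyMeasurable (F i) μ) (hfin : ∫⁻ t, ∑' i, ‖F i t‖ₑ ∂μ ≠ ⊤) :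
    HasSum (fun i => ∫ t, F i t ∂μ) (∫ t, ∑' i, F i t ∂μ) := by
  rw [lintegral_tsum fun i => (hF i).enorm] at hfin
  rw [integral_tsum hF hfin]
  refine (Summable.of_norm (tsum_enorm_ne_top_iff_summable_norm.1 ?_)).hasSum
  exact ne_top_of_le_ne_top hfin
    (ENNReal.tsum_le_tsum fun i => enorm_integral_le_lintegral_enorm _)

end Series

section Cells

variable {T : ℝ}

theorem preimage_sub_Ioc (T x : ℝ) (j : ℤ) :
    (fun t => t - j * T) ⁻¹' Set.Ioc x (x + T) = Set.Ioc (x + j • T) (x + (j + 1) • T) := by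
  rw [Set.preimage_sub_const_Ioc, zsmul_eq_mul, zsmul_eq_mul]
  congr 1
  push_cast
  ring

theorem iUnion_preimage_sub_Ioc (hT : 0 < T) (x : ℝ) :
    ⋃ j : ℤ, (fun t => t - j * T) ⁻¹' Set.Ioc x (x + T) = Set.univ := by
  simp only [preimage_sub_Ioc]
  exact iUnion_Ioc_add_zsmul hT x

theorem pairwise_disjoint_preimage_sub_Ioc (T x : ℝ) :
    Pairwise (Function.onFun Disjoint
      fun j : ℤ => (fun t : ℝ => t - j * T) ⁻¹' Set.Ioc x (x + T)) := by
  simp only [preimage_sub_Ioc]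
  exact Set.pairwise_disjoint_Ioc_add_zsmul x T

theorem eq_zero_of_add_mul_mem_Ioc {x t : ℝ} {j : ℤ} (ht : t ∈ Set.Ioc x (x + T))
    (htj : t + j * T ∈ Set.Ioc x (x + T)) : j = 0 := by
  by_contra hj
  have hdisj := pairwise_disjoint_preimage_sub_Ioc T x (Ne.symm hj)
  refine Set.disjoint_left.1 hdisj (?_ : t + j * T ∈ _) ?_
  · simpa using htj
  · simpa using ht

theorem tsum_setLIntegral_Ioc_add (hT : 0 < T) (x : ℝ) (F : ℝ → ℝ≥0∞) :
    ∑' j : ℤ, ∫⁻ t in Set.Ioc x (x + T), F (t + j * T) = ∫⁻ t, F t := by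
  rw [← setLIntegral_univ F, ← iUnion_preimage_sub_Ioc hT x,
    lintegral_iUnion (fun j => measurableSet_Ioc.preimage (measurable_sub_const _))
      (pairwise_disjoint_preimage_sub_Ioc T x)]
  refine tsum_congr fun j => ?_
  rw [← (measurePreserving_add_right volume (j * T)).setLIntegral_comp_preimage_emb
    (MeasurableEquiv.addRight (j * T)).measurableEmbedding F, ← Set.preimage_comp]
  simp [Function.comp_def]

theorem hasSum_setIntegral_Ioc_add {E : Type*} [NormedAddCommGroup E] [NormedSpace ℝ E]
    (hT : 0 < T) (x : ℝ) {F : ℝ → E} (hF : Integrable F) :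
    HasSum (fun j : ℤ => ∫ t in Set.Ioc x (x + T), F (t + j * T)) (∫ t, F t) := by
  rw [← setIntegral_univ (f := F), ← iUnion_preimage_sub_Ioc hT x]
  refine (hasSum_integral_iUnion (fun j => measurableSet_Ioc.preimage (measurable_sub_const _))
    (pairwise_disjoint_preimage_sub_Ioc T x) hF.integrableOn).congr_fun fun j => ?_
  rw [← (measurePreserving_add_right volume (j * T)).setIntegral_preimage_emb
    (MeasurableEquiv.addRight (j * T)).measurableEmbedding F, ← Set.preimage_comp]
  simp [Function.comp_def]

theorem ae_of_forall_ae_restrict_Ioc (hT : 0 < T) {p : ℝ → Prop}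
    (h : ∀ x, ∀ᵐ t ∂volume.restrict (Set.Ioc x (x + T)), p t) : ∀ᵐ t, p t := by
  rw [← Measure.restrict_univ (μ := (volume : Measure ℝ)), ← iUnion_Ioc_add_zsmul hT 0,
    ae_restrict_iUnion_iff]
  intro j
  rw [add_smul, one_smul, ← add_assoc]
  exact h _

theorem ae_eq_restrict_of_forall_setIntegral_eq {E : Type*} [NormedAddCommGroup E]
    [NormedSpace ℝ E] [CompleteSpace E] {J : Set ℝ} (hJ : MeasurableSet J) {u v : ℝ → E}
    (hu : IntegrableOn u J) (hv : IntegrableOn v J)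
    (huv : ∀ D ⊆ J, MeasurableSet D → ∫ t in D, u t = ∫ t in D, v t) :
    u =ᵐ[volume.restrict J] v := by
  refine hu.ae_eq_of_forall_setIntegral_eq _ _ hv fun D hD _ => ?_
  rw [Measure.restrict_restrict hD]
  exact huv _ Set.inter_subset_right (hD.inter hJ)

theorem ae_le_restrict_of_forall_setIntegral_le {J : Set ℝ} (hJ : MeasurableSet J) {u v : ℝ → ℝ}
    (hu : IntegrableOn u J) (hv : IntegrableOn v J)
    (huv : ∀ D ⊆ J, MeasurableSet D → ∫ t in D, u t ≤ ∫ t in D, v t) :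
    u ≤ᵐ[volume.restrict J] v := by
  refine ae_le_of_forall_setIntegral_le hu hv fun D hD _ => ?_
  rw [Measure.restrict_restrict hD]
  exact huv _ Set.inter_subset_right (hD.inter hJ)

end Cells

/-- The `a`-periodization `∑ₙ Φ(t - na)` of a function on the line. -/
def periodize (a : ℝ) (Φ : ℝ → ℂ) (t : ℝ) : ℂ := ∑' n : ℤ, Φ (t - n * a)

variable {a : ℝ} {Φ : ℝ → ℂ}

theorem setLIntegral_Ioc_tsum_sub (ha : 0 < a) (x : ℝ) {F : ℝ → ℝ≥0∞} (hF : AEMeasurable F) :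
    ∫⁻ t in Set.Ioc x (x + a), ∑' n : ℤ, F (t - n * a) = ∫⁻ t, F t := by
  have hmeas : ∀ n : ℤ, AEMeasurable (fun t => F (t - n * a))
      (volume.restrict (Set.Ioc x (x + a))) := fun n => (hF.comp_quasiMeasurePreserving
    (measurePreserving_sub_right volume (n * a)).quasiMeasurePreserving).restrict
  rw [lintegral_tsum hmeas, ← tsum_setLIntegral_Ioc_add ha x, ← (Equiv.neg ℤ).tsum_eq]
  simp [sub_eq_add_neg]

theorem setLIntegral_Ioc_tsum_sub_ne_top (ha : 0 < a) (x T : ℝ) {F : ℝ → ℝ≥0∞}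
    (hF : AEMeasurable F) (hfin : ∫⁻ t, F t ≠ ⊤) :
    ∫⁻ t in Set.Ioc x (x + T), ∑' n : ℤ, F (t - n * a) ≠ ⊤ := by
  have hmultiple : ∀ N : ℕ, ∫⁻ t in Set.Ioc x (x + N * a), ∑' n : ℤ, F (t - n * a) ≠ ⊤ := by
    intro N
    induction N with
    | zero => simp
    | succ N ih =>
      have hsplit : Set.Ioc x (x + (N + 1 : ℕ) * a) =
          Set.Ioc x (x + N * a) ∪ Set.Ioc (x + N * a) (x + N * a + a) := by
        rw [Set.Ioc_union_Ioc_eq_Ioc (le_add_of_nonneg_right (by positivity)) (by linarith)]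
        push_cast
        ring_nf
      rw [hsplit]
      refine ne_top_of_le_ne_top (ENNReal.add_ne_top.2 ⟨ih, ?_⟩) (lintegral_union_le _ _ _)
      rwa [setLIntegral_Ioc_tsum_sub ha _ hF]
  obtain ⟨N, hN⟩ := exists_nat_ge (T / a)
  refine ne_top_of_le_ne_top (hmultiple N) (lintegral_mono_set (Set.Ioc_subset_Ioc_right ?_))
  rw [div_le_iff₀ ha] at hN
  linarith

theorem aestronglyMeasurable_comp_sub (hΦ : AEStronglyMeasurable Φ) (y : ℝ) :
    AEStronglyMeasurable fun t => Φ (t - y) :=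
  hΦ.comp_measurePreserving (measurePreserving_sub_right volume y)

theorem lintegral_tsum_enorm_sub_ne_top (ha : 0 < a) (hΦ : Integrable Φ) {D : Set ℝ} {x T : ℝ}
    (hD : D ⊆ Set.Ioc x (x + T)) : ∫⁻ t in D, ∑' n : ℤ, ‖Φ (t - n * a)‖ₑ ≠ ⊤ :=
  ne_top_of_le_ne_top (setLIntegral_Ioc_tsum_sub_ne_top ha x T hΦ.1.enorm hΦ.2.ne)
    (lintegral_mono_set hD)

theorem ae_summable_sub_mul (ha : 0 < a) (hΦ : Integrable Φ) :
    ∀ᵐ t, Summable fun n : ℤ => Φ (t - n * a) :=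
  ae_of_forall_ae_restrict_Ioc ha fun _ => ae_summable_of_lintegral_tsum_enorm_ne_top
    (fun _ => (aestronglyMeasurable_comp_sub hΦ.1 _).restrict)
    (lintegral_tsum_enorm_sub_ne_top ha hΦ subset_rfl)

theorem integrableOn_periodize (ha : 0 < a) (hΦ : Integrable Φ) (x T : ℝ) :
    IntegrableOn (periodize a Φ) (Set.Ioc x (x + T)) :=
  integrable_tsum_of_lintegral_tsum_enorm_ne_top
    (fun _ => (aestronglyMeasurable_comp_sub hΦ.1 _).restrict)
    (lintegral_tsum_enorm_sub_ne_top ha hΦ subset_rfl)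

theorem hasSum_setIntegral_sub_mul (ha : 0 < a) (hΦ : Integrable Φ) {D : Set ℝ} {x T : ℝ}
    (hD : D ⊆ Set.Ioc x (x + T)) :
    HasSum (fun n : ℤ => ∫ t in D, Φ (t - n * a)) (∫ t in D, periodize a Φ t) :=
  hasSum_integral_of_lintegral_tsum_enorm_ne_top
    (fun _ => (aestronglyMeasurable_comp_sub hΦ.1 _).restrict)
    (lintegral_tsum_enorm_sub_ne_top ha hΦ hD)

end Periodization

/-! ### Parseval's identity on an interval -/

section Parseval

open scoped FourierTransform ComplexConjugate

variable {T : ℝ} [Fact (0 < T)] {x : ℝ} {p q : ℝ → ℂ}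

theorem fourierCoeff_liftIoc (T x : ℝ) [Fact (0 < T)] (p : ℝ → ℂ) (m : ℤ) :
    fourierCoeff (AddCircle.liftIoc T x p) m =
      (T : ℂ)⁻¹ * ∫ t in Set.Ioc x (x + T), 𝐞 (-m / T * t) * p t := by
  have hT : 0 < T := Fact.out
  rw [fourierCoeff_eq_intervalIntegral _ _ x, intervalIntegral.integral_of_le (by linarith),
    ← Complex.coe_smul, smul_eq_mul, one_div, Complex.ofReal_inv]
  congr 1
  refine setIntegral_congr_fun measurableSet_Ioc fun t ht => ?_
  rw [AddCircle.liftIoc_coe_apply ht, fourier_coe_apply, smul_eq_mul, ← exp_two_pi_I_mul]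
  congr 2
  push_cast
  ring

theorem inner_toLp_liftIoc
    (hp : MemLp (AddCircle.liftIoc T x p) 2 (AddCircle.haarAddCircle (T := T)))
    (hq : MemLp (AddCircle.liftIoc T x q) 2 (AddCircle.haarAddCircle (T := T))) :
    inner ℂ (hq.toLp _) (hp.toLp _) = (T : ℂ)⁻¹ * ∫ t in Set.Ioc x (x + T), conj (q t) * p t := by
  have hT : 0 < T := Fact.out
  have hlift : inner ℂ (hq.toLp _) (hp.toLp _) =
      ∫ t, AddCircle.liftIoc T x (fun t => conj (q t) * p t) t ∂AddCircle.haarAddCircle := by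
    rw [L2.inner_def]
    refine integral_congr_ae ?_
    filter_upwards [hq.coeFn_toLp, hp.coeFn_toLp] with t hqt hpt
    rw [hqt, hpt, RCLike.inner_apply']
    rfl
  rw [hlift, AddCircle.integral_haarAddCircle, AddCircle.integral_liftIoc_eq_intervalIntegral,
    intervalIntegral.integral_of_le (by linarith), ← Complex.coe_smul, smul_eq_mul,
    Complex.ofReal_inv]

theorem hasSum_conj_integral_mul_integral {T : ℝ} (hT : 0 < T) (x : ℝ) {p q : ℝ → ℂ}
    (hp : MemLp p 2 (volume.restrict (Set.Ioc x (x + T))))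
    (hq : MemLp q 2 (volume.restrict (Set.Ioc x (x + T)))) :
    HasSum (fun m : ℤ => conj (∫ t in Set.Ioc x (x + T), 𝐞 (m / T * t) * q t) *
        ∫ t in Set.Ioc x (x + T), 𝐞 (m / T * t) * p t)
      (T * ∫ t in Set.Ioc x (x + T), conj (q t) * p t) := by
  have : Fact (0 < T) := ⟨hT⟩
  have hTc : (T : ℂ) ≠ 0 := Complex.ofReal_ne_zero.2 hT.ne'
  have hP := hp.memLp_liftIoc.haarAddCircle
  have hQ := hq.memLp_liftIoc.haarAddCircle
  have hcoeff : ∀ {r : ℝ → ℂ} (hr : MemLp (AddCircle.liftIoc T x r) 2 AddCircle.haarAddCircle)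
      (m : ℤ), inner ℂ (fourierBasis (T := T) (-m)) (hr.toLp _) =
        (T : ℂ)⁻¹ * ∫ t in Set.Ioc x (x + T), 𝐞 (m / T * t) * r t := by
    intro r hr m
    rw [← HilbertBasis.repr_apply_apply, fourierBasis_repr, fourierCoeff_congr_ae hr.coeFn_toLp,
      fourierCoeff_liftIoc, Int.cast_neg, neg_neg]
  have hsum := ((Equiv.neg ℤ).hasSum_iff.2
    ((fourierBasis (T := T)).hasSum_inner_mul_inner (hQ.toLp _) (hP.toLp _))).mul_left
      ((T : ℂ) * T)
  rw [inner_toLp_liftIoc hP hQ, mul_assoc, mul_inv_cancel_left₀ hTc] at hsum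
  refine hsum.congr_fun fun m => ?_
  simp only [Function.comp_apply, Equiv.neg_apply]
  rw [← inner_conj_symm (hQ.toLp _), hcoeff hQ, hcoeff hP, map_mul, map_inv₀, Complex.conj_ofReal]
  field_simp

end Parseval

/-! ### Fibre matrices and Walnut's representation -/

section Fibers

open scoped FourierTransform ComplexConjugate

/-- The matrix by which the frame operator of `(g, a, b)` acts on the fibre `t + ℤ / b`: its rows
and columns are indexed by the points `t + j / b`. -/
def fiberMatrix (g : L2R) (a b t : ℝ) (j l : ℤ) : ℂ :=
  (1 / b : ℝ) * corr g a b (j - l) (t + j / b)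

theorem fiberMatrix_eq (g : L2R) (a b t : ℝ) (j l : ℤ) :
    fiberMatrix g a b t j l =
      (1 / b : ℝ) * periodize a (fun u => g (u + j / b) * conj (g (u + l / b))) t := by
  unfold fiberMatrix corr periodize
  congr 2
  funext n
  congr 3 <;> push_cast <;> ring

theorem conj_fiberMatrix (g : L2R) (a b t : ℝ) (j l : ℤ) :
    conj (fiberMatrix g a b t j l) = fiberMatrix g a b t l j := by
  simp only [fiberMatrix_eq, periodize, map_mul, Complex.conj_ofReal, Complex.conj_tsum,
    Complex.conj_conj, mul_comm]

theorem memLp_comp_add (f : L2R) (y : ℝ) : MemLp (fun t => f (t + y)) 2 volume :=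
  (Lp.memLp f).comp_measurePreserving (measurePreserving_add_right volume y)

theorem integrableOn_comp_add (f : L2R) (y x T : ℝ) :
    IntegrableOn (fun t => f (t + y)) (Set.Ioc x (x + T)) :=
  ((memLp_comp_add f y).restrict _).integrable one_le_two

theorem integrable_mul_conj_comp_add (g : L2R) (y z : ℝ) :
    Integrable fun u => g (u + y) * conj (g (u + z)) :=
  (memLp_comp_add g y).integrable_mul (memLp_comp_add g z).star

theorem integrableOn_fiberMatrix {a : ℝ} (ha : 0 < a) (b x T : ℝ) (g : L2R) (j l : ℤ) :
    IntegrableOn (fun t => fiberMatrix g a b t j l) (Set.Ioc x (x + T)) := by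
  simp only [fiberMatrix_eq]
  exact (integrableOn_periodize ha (integrable_mul_conj_comp_add g _ _) x T).const_mul _

variable {D E : Set ℝ} (hD : MeasurableSet D) (hD' : volume D ≠ ⊤)
  (hE : MeasurableSet E) (hE' : volume E ≠ ⊤)

/-- The indicator function of the translate `D + y`, as an element of `L²(ℝ)`. Pairing with these
functions for small `D` tests identities on fibres. -/
def shiftInd (y : ℝ) : L2R :=
  indicatorConstLp 2 (s := (fun t => t - y) ⁻¹' D) (hD.preimage (measurable_sub_const y))
    (by rwa [(measurePreserving_sub_right volume y).measure_preimage hD.nullMeasurableSet]) 1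

theorem inner_shiftInd (y : ℝ) (f : L2R) :
    inner ℂ (shiftInd hD hD' y) f = ∫ t in D, f (t + y) := by
  rw [shiftInd, L2.inner_indicatorConstLp_one,
    ← (measurePreserving_add_right volume y).setIntegral_preimage_emb
      (MeasurableEquiv.addRight y).measurableEmbedding]
  congr 2
  ext t
  simp

theorem coeFn_shiftInd (y : ℝ) :
    ∀ᵐ t, shiftInd hD hD' y (t + y) = D.indicator (fun _ => (1 : ℂ)) t := by
  have hcoe : shiftInd hD hD' y =ᵐ[volume]
      ((fun t => t - y) ⁻¹' D).indicator fun _ => (1 : ℂ) := indicatorConstLp_coeFn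
  filter_upwards [ae_add hcoe y] with t ht
  rw [ht]
  by_cases htD : t ∈ D <;> simp [htD]

variable {a b x : ℝ} (hb : 0 < b) (hDJ : D ⊆ Set.Ioc x (x + 1 / b))

include hDJ in
theorem shiftInd_apply_ae (j l : ℤ) :
    ∀ᵐ t, t ∈ D → shiftInd hD hD' (l / b) (t + j / b) = if j = l then 1 else 0 := by
  filter_upwards [ae_add (coeFn_shiftInd hD hD' (l / b)) (j / b - l / b)] with t ht htD
  rw [add_assoc, sub_add_cancel] at ht
  rw [ht]
  split_ifs with hjl
  · simp [hjl, htD]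
  · refine Set.indicator_of_notMem (fun hmem => hjl (sub_eq_zero.1 ?_)) _
    refine eq_zero_of_add_mul_mem_Ioc (T := 1 / b) (hDJ htD) ?_
    rw [mul_one_div, Int.cast_sub, sub_div]
    exact hDJ hmem

include hDJ in
theorem inner_shiftInd_shiftInd (j l : ℤ) :
    inner ℂ (shiftInd hD hD' (j / b)) (shiftInd hD hD' (l / b)) =
      if j = l then (volume.real D : ℂ) else 0 := by
  rw [inner_shiftInd, setIntegral_congr_ae hD (shiftInd_apply_ae hD hD' hDJ j l),
    setIntegral_const]
  split_ifs <;> simp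

theorem fourierChar_mul_add_int_div (hb : b ≠ 0) (m j : ℤ) (t : ℝ) :
    (𝐞 (m * b * (t + j / b)) : ℂ) = 𝐞 (m / (1 / b) * t) := by
  have hphase : m * b * (t + j / b) = (m * j : ℤ) + m / (1 / b) * t := by
    push_cast
    field_simp
    ring
  rw [hphase, AddChar.map_add_eq_mul, Real.fourierChar_apply' (m * j : ℤ),
    mul_comm (2 * Real.pi), Circle.exp_int_mul_two_pi, one_mul]

include hDJ hb in
theorem inner_shiftInd_whSystem (a : ℝ) (g : L2R) (j m n : ℤ) :
    inner ℂ (shiftInd hD hD' (j / b)) (whSystem g a b (m, n)) =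
      ∫ t in Set.Ioc x (x + 1 / b), 𝐞 (m / (1 / b) * t) *
        D.indicator (fun t => g (t - n * a + j / b)) t := by
  have hmul : ∀ t, (𝐞 (m / (1 / b) * t) : ℂ) * D.indicator (fun t => g (t - n * a + j / b)) t =
      D.indicator (fun t => 𝐞 (m / (1 / b) * t) * g (t - n * a + j / b)) t :=
    fun t => by by_cases htD : t ∈ D <;> simp [htD]
  simp only [hmul]
  rw [inner_shiftInd, setIntegral_indicator hD, Set.inter_eq_right.2 hDJ]
  refine setIntegral_congr_ae hD ?_
  filter_upwards [ae_add (coeFn_modTrans (m * b) (n * a) g) (j / b)] with t ht _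
  rw [whSystem, ht, fourierChar_mul_add_int_div hb.ne', add_sub_right_comm]

variable (ha : 0 < a) {g : L2R} (h : HasUpperFrameBound (whSystem g a b))
  (hEJ : E ⊆ Set.Ioc x (x + 1 / b))

include ha h hb hDJ hEJ in
theorem inner_shiftInd_frameOperator (j l : ℤ) :
    inner ℂ (shiftInd hD hD' (j / b)) (frameOperator (whSystem g a b) (shiftInd hE hE' (l / b))) =
      ∫ t in D ∩ E, fiberMatrix g a b t j l := by
  have hinter : D ∩ E ⊆ Set.Ioc x (x + 1 / b) := Set.inter_subset_left.trans hDJ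
  have hmem : ∀ {D : Set ℝ} (_ : MeasurableSet D) (n k : ℤ),
      MemLp (D.indicator fun t => g (t - n * a + k / b)) 2
        (volume.restrict (Set.Ioc x (x + 1 / b))) := fun hD n k => by
    simp only [sub_add_eq_add_sub, add_sub_assoc]
    exact ((memLp_comp_add g _).indicator hD).restrict _
  have hprod : ∀ n : ℤ, (fun t => conj (E.indicator (fun t => g (t - n * a + l / b)) t) *
      D.indicator (fun t => g (t - n * a + j / b)) t) =
      (D ∩ E).indicator fun t => g (t - n * a + j / b) * conj (g (t - n * a + l / b)) := by
    intro n
    funext t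
    by_cases htD : t ∈ D <;> by_cases htE : t ∈ E <;> simp [htD, htE, mul_comm]
  have hmodulations : ∀ n : ℤ, HasSum (fun m : ℤ =>
      inner ℂ (whSystem g a b (m, n)) (shiftInd hE hE' (l / b)) *
        inner ℂ (shiftInd hD hD' (j / b)) (whSystem g a b (m, n)))
      ((1 / b : ℝ) * ∫ t in D ∩ E, g (t - n * a + j / b) * conj (g (t - n * a + l / b))) := by
    intro n
    have hparseval := hasSum_conj_integral_mul_integral (one_div_pos.2 hb) x (hmem hD n j)
      (hmem hE n l)
    rw [hprod, setIntegral_indicator (hD.inter hE), Set.inter_eq_right.2 hinter] at hparseval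
    refine hparseval.congr_fun fun m => ?_
    rw [← inner_conj_symm (whSystem g a b (m, n)), inner_shiftInd_whSystem hD hD' hb hDJ,
      inner_shiftInd_whSystem hE hE' hb hEJ]
  have htranslations := ((Equiv.prodComm ℤ ℤ).hasSum_iff.2 (h.hasSum_inner_frameOperator
    (shiftInd hE hE' (l / b)) (shiftInd hD hD' (j / b)))).prod_fiberwise hmodulations
  refine htranslations.unique ?_
  simp only [fiberMatrix_eq]
  rw [integral_const_mul]
  exact (hasSum_setIntegral_sub_mul ha (integrable_mul_conj_comp_add g _ _) hinter).mul_left _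

theorem volume_ne_top_of_subset_Ioc {x y : ℝ} (hD : D ⊆ Set.Ioc x y) : volume D ≠ ⊤ :=
  measure_ne_top_of_subset hD measure_Ioc_lt_top.ne

include ha h hb hEJ in
theorem frameOperator_shiftInd_ae (j l : ℤ) :
    (fun t => frameOperator (whSystem g a b) (shiftInd hE hE' (l / b)) (t + j / b))
      =ᵐ[volume.restrict (Set.Ioc x (x + 1 / b))] E.indicator fun t => fiberMatrix g a b t j l := by
  refine ae_eq_restrict_of_forall_setIntegral_eq measurableSet_Ioc (integrableOn_comp_add _ _ _ _)
    ((integrableOn_fiberMatrix ha b x (1 / b) g j l).indicator hE) fun D hDJ hD => ?_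
  rw [← inner_shiftInd hD (volume_ne_top_of_subset_Ioc hDJ),
    inner_shiftInd_frameOperator hD _ hE hE' hb hDJ ha h hEJ, setIntegral_indicator hE]

include ha h hb hDJ in
theorem conj_frameOperator_shiftInd_mul_ae (f : L2R) (i j : ℤ) :
    (fun t => conj (frameOperator (whSystem g a b) (shiftInd hD hD' (i / b)) (t + j / b)) *
        f (t + j / b))
      =ᵐ[volume.restrict (Set.Ioc x (x + 1 / b))]
        D.indicator fun t => fiberMatrix g a b t i j * f (t + j / b) := by
  filter_upwards [frameOperator_shiftInd_ae hD hD' hb ha h hDJ j i] with t ht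
  rw [ht]
  by_cases htD : t ∈ D <;> simp [htD, conj_fiberMatrix]

theorem integrable_conj_mul (u f : L2R) : Integrable fun t => conj (u t) * f t := by
  simpa only [RCLike.inner_apply'] using L2.integrable_inner (𝕜 := ℂ) u f

include ha in
theorem aestronglyMeasurable_fiberMatrix_mul (g f : L2R) (b x T : ℝ) (i j : ℤ) :
    AEStronglyMeasurable (fun t => fiberMatrix g a b t i j * f (t + j / b))
      (volume.restrict (Set.Ioc x (x + T))) :=
  (integrableOn_fiberMatrix ha b x T g i j).1.mul (integrableOn_comp_add f _ _ _).1

include ha h hb in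
theorem lintegral_tsum_enorm_fiberMatrix_mul_ne_top (x : ℝ) (f : L2R) (i : ℤ) :
    ∫⁻ t in Set.Ioc x (x + 1 / b), ∑' j : ℤ, ‖fiberMatrix g a b t i j * f (t + j / b)‖ₑ ≠ ⊤ := by
  set u := frameOperator (whSystem g a b)
    (shiftInd (D := Set.Ioc x (x + 1 / b)) measurableSet_Ioc measure_Ioc_lt_top.ne (i / b))
  have hcell : ∀ j : ℤ, ∫⁻ t in Set.Ioc x (x + 1 / b), ‖fiberMatrix g a b t i j * f (t + j / b)‖ₑ =
      ∫⁻ t in Set.Ioc x (x + 1 / b), ‖conj (u (t + j * (1 / b))) * f (t + j * (1 / b))‖ₑ := by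
    intro j
    refine lintegral_congr_ae ?_
    filter_upwards [conj_frameOperator_shiftInd_mul_ae measurableSet_Ioc measure_Ioc_lt_top.ne hb
      subset_rfl ha h f i j, ae_restrict_mem measurableSet_Ioc] with t ht htJ
    rw [mul_one_div, ht, Set.indicator_of_mem htJ]
  rw [lintegral_tsum fun j => (aestronglyMeasurable_fiberMatrix_mul ha g f b x _ i j).enorm,
    tsum_congr hcell, tsum_setLIntegral_Ioc_add (one_div_pos.2 hb) x fun t => ‖conj (u t) * f t‖ₑ]
  exact (integrable_conj_mul u f).2.ne

include ha h hb hD hDJ in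
theorem hasSum_setIntegral_fiberMatrix_mul (f : L2R) (i : ℤ) :
    HasSum (fun j : ℤ => ∫ t in D, fiberMatrix g a b t i j * f (t + j / b))
      (∫ t in D, frameOperator (whSystem g a b) f (t + i / b)) := by
  have hD' := volume_ne_top_of_subset_Ioc hDJ
  set u := frameOperator (whSystem g a b) (shiftInd hD hD' (i / b))
  have hpair : ∫ t in D, frameOperator (whSystem g a b) f (t + i / b) =
      ∫ t, conj (u t) * f t := by
    rw [← inner_shiftInd hD hD', ← h.inner_frameOperator_comm, L2.inner_def]
    simp only [RCLike.inner_apply', u]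
  rw [hpair]
  refine (hasSum_setIntegral_Ioc_add (one_div_pos.2 hb) x (integrable_conj_mul u f)).congr_fun
    fun j => ?_
  simp only [mul_one_div]
  rw [integral_congr_ae (conj_frameOperator_shiftInd_mul_ae hD hD' hb hDJ ha h f i j),
    setIntegral_indicator hD, Set.inter_eq_right.2 hDJ]

include ha h hb in
theorem hasSum_fiberMatrix_mul_ae (f : L2R) :
    ∀ᵐ t, ∀ i : ℤ, HasSum (fun l : ℤ => fiberMatrix g a b t i l * f (t + l / b))
      (frameOperator (whSystem g a b) f (t + i / b)) := by
  refine ae_all_iff.2 fun i => ae_of_forall_ae_restrict_Ioc (one_div_pos.2 hb) fun x => ?_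
  have hmeas := fun j => aestronglyMeasurable_fiberMatrix_mul ha g f b x (1 / b) i j
  have hfin := lintegral_tsum_enorm_fiberMatrix_mul_ne_top hb ha h x f i
  have heq := ae_eq_restrict_of_forall_setIntegral_eq measurableSet_Ioc
    (integrableOn_comp_add (frameOperator (whSystem g a b) f) (i / b) x (1 / b))
    (integrable_tsum_of_lintegral_tsum_enorm_ne_top hmeas hfin) fun D hDJ hD =>
      (hasSum_setIntegral_fiberMatrix_mul hD hb hDJ ha h f i).unique
        (hasSum_integral_of_lintegral_tsum_enorm_ne_top
          (fun j => (hmeas j).mono_set hDJ) (ne_top_of_le_ne_top hfin (lintegral_mono_set hDJ)))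
  filter_upwards [ae_summable_of_lintegral_tsum_enorm_ne_top hmeas hfin, heq] with t hsum ht
  rw [ht]
  exact hsum.hasSum

end Fibers

section Forms

open scoped ComplexConjugate

theorem hermForm_diagonal {ι : Type*} [DecidableEq ι] (r : ℂ) (s : Finset ι) (c : ι → ℂ) :
    hermForm (fun j l => if j = l then r else 0) s c = r * ∑ j ∈ s, (‖c j‖ : ℂ) ^ 2 := by
  rw [hermForm, Finset.mul_sum]
  refine Finset.sum_congr rfl fun j hj => ?_
  rw [Finset.sum_eq_single_of_mem j hj fun l _ hl => by simp [hl.symm], if_pos rfl,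
    ← Complex.conj_mul']
  ring

theorem CoerciveWith.of_denseRange {ι κ : Type*} {α : ℝ} {M : ι → ι → ℂ} {d : κ → ι → ℂ}
    (hd : DenseRange d)
    (hM : ∀ s n, α * ∑ j ∈ s, ‖d n j‖ ^ 2 ≤ (hermForm M s (d n)).re) : CoerciveWith α M := by
  intro s c
  refine hd.induction_on (p := fun c => α * ∑ j ∈ s, ‖c j‖ ^ 2 ≤ (hermForm M s c).re) c ?_ (hM s)
  unfold hermForm
  exact isClosed_le (by fun_prop) (by fun_prop)

section Integral

variable {Ω ι : Type*} [MeasurableSpace Ω] {μ : Measure Ω} {M : Ω → ι → ι → ℂ}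

theorem integrable_hermForm (hM : ∀ j l, Integrable (fun t => M t j l) μ) (s : Finset ι)
    (c : ι → ℂ) : Integrable (fun t => hermForm (M t) s c) μ :=
  integrable_finsetSum s fun j _ => integrable_finsetSum s fun l _ =>
    ((hM j l).const_mul _).mul_const _

theorem integral_hermForm (hM : ∀ j l, Integrable (fun t => M t j l) μ) (s : Finset ι)
    (c : ι → ℂ) :
    ∫ t, hermForm (M t) s c ∂μ = hermForm (fun j l => ∫ t, M t j l ∂μ) s c := by
  have hterm : ∀ j l, Integrable (fun t => conj (c j) * M t j l * c l) μ :=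
    fun j l => ((hM j l).const_mul _).mul_const _
  simp only [hermForm]
  rw [integral_finsetSum s fun j _ => integrable_finsetSum s fun l _ => hterm j l]
  refine Finset.sum_congr rfl fun j _ => ?_
  rw [integral_finsetSum s fun l _ => hterm j l]
  simp only [integral_mul_const, integral_const_mul]

end Integral

variable {a b x : ℝ} {g : L2R} {D : Set ℝ} (hD : MeasurableSet D) (hD' : volume D ≠ ⊤)
  (ha : 0 < a) (hb : 0 < b) (h : HasUpperFrameBound (whSystem g a b))
  (hDJ : D ⊆ Set.Ioc x (x + 1 / b))

include hDJ in
theorem norm_sq_sum_shiftInd (s : Finset ℤ) (c : ℤ → ℂ) :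
    ‖∑ j ∈ s, c j • shiftInd hD hD' (j / b)‖ ^ 2 = volume.real D * ∑ j ∈ s, ‖c j‖ ^ 2 := by
  have hform := inner_sum_smul_map_sum_smul (.id ℂ L2R) (fun j : ℤ => shiftInd hD hD' (j / b)) s c
  simp only [ContinuousLinearMap.id_apply, inner_shiftInd_shiftInd hD hD' hDJ,
    hermForm_diagonal] at hform
  rw [norm_sq_eq_re_inner (𝕜 := ℂ), hform, RCLike.re_eq_complex_re, Complex.re_ofReal_mul]
  norm_cast

include ha hb h hDJ in
theorem inner_sum_shiftInd_frameOperator (s : Finset ℤ) (c : ℤ → ℂ) :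
    inner ℂ (∑ j ∈ s, c j • shiftInd hD hD' (j / b))
        (frameOperator (whSystem g a b) (∑ j ∈ s, c j • shiftInd hD hD' (j / b))) =
      ∫ t in D, hermForm (fiberMatrix g a b t) s c := by
  obtain ⟨S, hS⟩ := h.exists_clm_eq
  rw [integral_hermForm fun j l => (integrableOn_fiberMatrix ha b x _ g j l).mono_set hDJ, ← hS,
    inner_sum_smul_map_sum_smul]
  simp only [hS, inner_shiftInd_frameOperator hD hD' hD hD' hb hDJ ha h hDJ, Set.inter_self]

include ha hb h in
theorem le_re_hermForm_fiberMatrix_ae {A : ℝ}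
    (hA : ∀ f, A * ‖f‖ ^ 2 ≤ (inner ℂ f (frameOperator (whSystem g a b) f)).re)
    (s : Finset ℤ) (c : ℤ → ℂ) :
    ∀ᵐ t, A * ∑ j ∈ s, ‖c j‖ ^ 2 ≤ (hermForm (fiberMatrix g a b t) s c).re := by
  refine ae_of_forall_ae_restrict_Ioc (one_div_pos.2 hb) fun x => ?_
  have hint : IntegrableOn (fun t => hermForm (fiberMatrix g a b t) s c)
      (Set.Ioc x (x + 1 / b)) := integrable_hermForm (integrableOn_fiberMatrix ha b x _ g) s c
  refine ae_le_restrict_of_forall_setIntegral_le measurableSet_Ioc (integrable_const _) hint.re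
    fun D hDJ hD => ?_
  have hD' := volume_ne_top_of_subset_Ioc hDJ
  have hre := integral_re (hint.mono_set hDJ)
  rw [← inner_sum_shiftInd_frameOperator hD hD' ha hb h hDJ] at hre
  simp only [RCLike.re_eq_complex_re] at hre
  rw [hre, setIntegral_const, smul_eq_mul, mul_left_comm, ← norm_sq_sum_shiftInd hD hD' hDJ]
  exact hA _

include ha hb h in
theorem coerciveWith_fiberMatrix_ae {A : ℝ}
    (hA : ∀ f, A * ‖f‖ ^ 2 ≤ (inner ℂ f (frameOperator (whSystem g a b) f)).re) :
    ∀ᵐ t, CoerciveWith A (fiberMatrix g a b t) := by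
  obtain ⟨d, hd⟩ := TopologicalSpace.exists_dense_seq (ℤ → ℂ)
  have hdense : ∀ᵐ t, ∀ s n, A * ∑ j ∈ s, ‖d n j‖ ^ 2 ≤
      (hermForm (fiberMatrix g a b t) s (d n)).re :=
    ae_all_iff.2 fun s => ae_all_iff.2 fun n => le_re_hermForm_fiberMatrix_ae ha hb h hA s (d n)
  exact hdense.mono fun t ht => .of_denseRange hd ht

include ha hb h in
theorem re_fiberMatrix_diag_le_ae {B : ℝ}
    (hB : ∀ f, (inner ℂ f (frameOperator (whSystem g a b) f)).re ≤ B * ‖f‖ ^ 2) (j : ℤ) :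
    ∀ᵐ t, (fiberMatrix g a b t j j).re ≤ B := by
  refine ae_of_forall_ae_restrict_Ioc (one_div_pos.2 hb) fun x => ?_
  have hint := integrableOn_fiberMatrix ha b x (1 / b) g j j
  refine ae_le_restrict_of_forall_setIntegral_le measurableSet_Ioc hint.re (integrable_const _)
    fun D hDJ hD => ?_
  have hD' := volume_ne_top_of_subset_Ioc hDJ
  have hnorm : ‖shiftInd hD hD' (j / b)‖ ^ 2 = volume.real D := by
    rw [norm_sq_eq_re_inner (𝕜 := ℂ), inner_shiftInd_shiftInd hD hD' hDJ, if_pos rfl]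
    exact Complex.ofReal_re _
  have hre := integral_re (hint.mono_set hDJ)
  simp only [RCLike.re_eq_complex_re] at hre
  have htest := hB (shiftInd hD hD' (j / b))
  rw [inner_shiftInd_frameOperator hD hD' hD hD' hb hDJ ha h hDJ, Set.inter_self, hnorm] at htest
  rw [hre, setIntegral_const, smul_eq_mul, mul_comm]
  exact htest

theorem re_fiberMatrix_zero_zero (g : L2R) (a b t : ℝ) :
    (fiberMatrix g a b t 0 0).re = 1 / b * ∑' n : ℤ, ‖g (t - n * a)‖ ^ 2 := by
  rw [fiberMatrix_eq, Complex.re_ofReal_mul, periodize]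
  simp only [Int.cast_zero, zero_div, add_zero, Complex.mul_conj']
  norm_cast

include ha hb h in
theorem exists_tsum_enorm_sq_le_ae :
    ∃ C ≠ ⊤, ∀ᵐ t, ∑' n : ℤ, ‖g (t - n * a)‖ₑ ^ 2 ≤ C := by
  have ⟨B, _, hfB⟩ := h
  refine ⟨ENNReal.ofReal (b * B), ENNReal.ofReal_ne_top, ?_⟩
  filter_upwards [re_fiberMatrix_diag_le_ae ha hb h
      (fun f => (h.re_inner_frameOperator f).trans_le (hfB f).2) 0,
    ae_summable_sub_mul ha (integrable_mul_conj_comp_add g 0 0)] with t hdiag hsum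
  simp only [add_zero, Complex.mul_conj'] at hsum
  have hsum' : Summable fun n : ℤ => ‖g (t - n * a)‖ ^ 2 := by exact_mod_cast hsum
  rw [re_fiberMatrix_zero_zero, one_div, inv_mul_le_iff₀ hb] at hdiag
  simp only [← ofReal_norm, ← ENNReal.ofReal_pow (norm_nonneg _)]
  rw [← ENNReal.ofReal_tsum_of_nonneg (fun _ => by positivity) hsum']
  exact ENNReal.ofReal_le_ofReal hdiag

include ha hb h in
theorem exists_enorm_corr_le_ae : ∃ C ≠ ⊤, ∀ᵐ t, ∀ k, ‖corr g a b k t‖ₑ ≤ C := by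
  obtain ⟨C, hC, hsum⟩ := exists_tsum_enorm_sq_le_ae ha hb h
  have hsum' : ∀ᵐ t, ∀ k : ℤ, ∑' n : ℤ, ‖g (t - k / b - n * a)‖ₑ ^ 2 ≤ C :=
    ae_all_iff.2 fun k => ae_sub hsum (k / b)
  refine ⟨C, hC, ?_⟩
  filter_upwards [hsum, hsum'] with t ht ht' k
  calc ‖corr g a b k t‖ₑ ≤ ∑' n : ℤ, ‖g (t - n * a)‖ₑ * ‖g (t - k / b - n * a)‖ₑ := by
        refine enorm_tsum_le_tsum_enorm.trans_eq (tsum_congr fun n => ?_)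
        rw [enorm_mul, RCLike.enorm_conj, sub_right_comm]
    _ ≤ C ^ (1 / 2 : ℝ) * C ^ (1 / 2 : ℝ) := by
        refine (tsum_mul_le_sqrt_mul_sqrt _ _).trans ?_
        gcongr
        exact ht' k
    _ = C := by
        rw [← ENNReal.rpow_add_of_nonneg _ _ (by norm_num) (by norm_num)]
        norm_num

end Forms

/-! ### The dual window -/

theorem uniformCC_iff {a b : ℝ} (ha : 0 < a) (hb : 0 < b) {g : L2R} :
    UniformCC g a b ↔ HasUpperFrameBound (whSystem g a b) ∧
      UniformlySummable (ae volume) fun t k => ‖corr g a b k t‖ₑ := by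
  refine and_congr_right fun h => ⟨fun htail => ?_, fun hsum ε hε => ?_⟩
  · obtain ⟨C, hC, hcorr⟩ := exists_enorm_corr_le_ae ha hb h
    refine .of_bounded (fun k => ⟨C, hC, hcorr.mono fun t ht => ht k⟩) fun δ hδ => ?_
    obtain ⟨r, hr, hrδ⟩ := ENNReal.lt_iff_exists_nnreal_btwn.1 (pos_iff_ne_zero.2 hδ)
    obtain ⟨K, -, hK⟩ := htail r (by exact_mod_cast hr)
    refine ⟨K, hK.mono fun t ht => ht.le.trans ?_⟩
    rw [ENNReal.ofReal_coe_nnreal]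
    exact hrδ.le
  · obtain ⟨K, hK⟩ := hsum.2 (ENNReal.ofReal (ε / 2)) (by simpa using hε)
    refine ⟨K + 1, K.succ_pos, hK.mono fun t ht => ?_⟩
    calc tail (fun k => ‖corr g a b k t‖ₑ) (K + 1)
        ≤ tail (fun k => ‖corr g a b k t‖ₑ) K := tail_anti _ K.le_succ
      _ ≤ ENNReal.ofReal (ε / 2) := ht
      _ < ENNReal.ofReal ε := (ENNReal.ofReal_lt_ofReal_iff hε).2 (half_lt_self hε)

section Rational

theorem corr_add_int_mul (g : L2R) (a b : ℝ) (k n : ℤ) (t : ℝ) :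
    corr g a b k (t + n * a) = corr g a b k t := by
  unfold corr
  rw [← (Equiv.addRight n).tsum_eq]
  refine tsum_congr fun m => ?_
  rw [Equiv.coe_addRight, Int.cast_add, add_mul, add_sub_add_right_eq_sub]

variable {a b : ℝ}

theorem corr_add_int_div (hb : b ≠ 0) {p q : ℤ} (hpq : (p : ℝ) = q * (a * b)) (g : L2R)
    (k j : ℤ) (t : ℝ) :
    corr g a b k (t + j / b) = corr g a b k (t + (j % p : ℤ) / b) := by
  have hj : (j : ℝ) = p * (j / p : ℤ) + (j % p : ℤ) := by
    exact_mod_cast (Int.mul_ediv_add_emod j p).symm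
  have hshift : t + j / b = t + (j % p : ℤ) / b + (j / p * q : ℤ) * a := by
    push_cast
    field_simp
    rw [hj, hpq]
    ring
  rw [hshift, corr_add_int_mul]

theorem exists_pos_int_eq_int_mul {x : ℝ} (hx : 0 < x) (hrat : ∃ r : ℚ, (r : ℝ) = x) :
    ∃ p q : ℤ, 0 < p ∧ (p : ℝ) = q * x := by
  obtain ⟨r, rfl⟩ := hrat
  refine ⟨r.num, r.den, Rat.num_pos.2 (by exact_mod_cast hx), ?_⟩
  exact_mod_cast (Rat.den_mul_eq_num r).symm

theorem exists_uniformlySummable_enorm_fiberMatrix_le (ha : 0 < a) (hb : 0 < b)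
    (hab : ∃ r : ℚ, (r : ℝ) = a * b) {g : L2R}
    (hg : UniformlySummable (ae volume) fun t k => ‖corr g a b k t‖ₑ) :
    ∃ m : ℝ → ℤ → ℝ≥0∞, UniformlySummable (ae volume) m ∧
      ∀ t j l, ‖fiberMatrix g a b t j l‖ₑ ≤ m t (j - l) := by
  obtain ⟨p, q, hp, hpq⟩ := exists_pos_int_eq_int_mul (mul_pos ha hb) hab
  have htranslate : ∀ y : ℝ, UniformlySummable (ae volume) fun t k => ‖corr g a b k (t + y)‖ₑ :=
    fun y => hg.comp_tendsto (u := (· + y)) (quasiMeasurePreserving_add_right volume y).tendsto_ae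
  have hsum : UniformlySummable (ae volume) fun t k =>
      ∑ i ∈ Finset.Ico 0 p, ‖corr g a b k (t + i / b)‖ₑ :=
    UniformlySummable.sum (Finset.Ico (0 : ℤ) p)
      (a := fun i t k => ‖corr g a b k (t + i / b)‖ₑ) fun i _ => htranslate (i / b)
  refine ⟨_, hsum.const_mul (c := ‖((1 / b : ℝ) : ℂ)‖ₑ) enorm_ne_top, fun t j l => ?_⟩
  rw [fiberMatrix, enorm_mul, corr_add_int_div hb.ne' hpq]
  gcongr
  exact Finset.single_le_sum (f := fun i : ℤ => ‖corr g a b (j - l) (t + i / b)‖ₑ)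
    (fun _ _ => zero_le) (Finset.mem_Ico.2 ⟨Int.emod_nonneg j hp.ne', Int.emod_lt_of_pos j hp⟩)

end Rational

section Dual

variable {a b : ℝ} {g : L2R}

theorem exists_enorm_fiberMatrix_le_ae (ha : 0 < a) (hb : 0 < b)
    (h : HasUpperFrameBound (whSystem g a b)) :
    ∃ C ≠ ⊤, ∀ᵐ t, ∀ j l, ‖fiberMatrix g a b t j l‖ₑ ≤ C := by
  obtain ⟨C, hC, hcorr⟩ := exists_enorm_corr_le_ae ha hb h
  refine ⟨‖((1 / b : ℝ) : ℂ)‖ₑ * C, by finiteness, ?_⟩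
  filter_upwards [ae_all_iff.2 fun j : ℤ => ae_add hcorr (j / b)] with t ht j l
  rw [fiberMatrix, enorm_mul]
  gcongr
  exact ht j _

theorem enorm_corr_eq_mul_enorm_fiberMatrix (hb : 0 < b) (g : L2R) (a t : ℝ) (k : ℤ) :
    ‖corr g a b k t‖ₑ = ENNReal.ofReal b * ‖fiberMatrix g a b t (-k) 0‖ₑ := by
  have hcorr : corr g a b k t = b * fiberMatrix g a b t 0 (-k) := by
    simp [fiberMatrix, hb.ne']
  rw [hcorr, enorm_mul, ← conj_fiberMatrix, RCLike.enorm_conj, ← ofReal_norm (b : ℂ),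
    Complex.norm_of_nonneg hb.le]

theorem hasUpperFrameBound_whSystem_dual (hg : IsFrame (whSystem g a b)) :
    HasUpperFrameBound (whSystem (hg.frameEquiv.symm g) a b) := by
  rw [whSystem_dual hg]
  exact hg.hasUpperFrameBound_dual

/-- Walnut's representation of the dual's frame operator `S⁻¹` identifies the column with `S⁻¹`
applied to the indicator of a cell, and `S` maps this back to the indicator. -/
theorem hasSum_fiberMatrix_mul_fiberMatrix_dual_ae (ha : 0 < a) (hb : 0 < b)
    (hg : IsFrame (whSystem g a b)) :
    ∀ᵐ t, ∀ j : ℤ, HasSum (fun l : ℤ => fiberMatrix g a b t j l *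
      fiberMatrix (hg.frameEquiv.symm g) a b t l 0) (if j = 0 then 1 else 0) := by
  refine ae_of_forall_ae_restrict_Ioc (one_div_pos.2 hb) fun x => ?_
  set e := shiftInd (D := Set.Ioc x (x + 1 / b)) measurableSet_Ioc measure_Ioc_lt_top.ne
    ((0 : ℤ) / b) with he
  have hcolumn : ∀ᵐ t ∂volume.restrict (Set.Ioc x (x + 1 / b)), ∀ l : ℤ,
      hg.frameEquiv.symm e (t + l / b) = fiberMatrix (hg.frameEquiv.symm g) a b t l 0 := by
    refine ae_all_iff.2 fun l => ?_
    filter_upwards [frameOperator_shiftInd_ae measurableSet_Ioc measure_Ioc_lt_top.ne hb ha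
      (hasUpperFrameBound_whSystem_dual hg) subset_rfl l 0, ae_restrict_mem measurableSet_Ioc]
      with t ht htJ
    rwa [Set.indicator_of_mem htJ, whSystem_dual hg, hg.frameOperator_dual, ← he] at ht
  have hcell : ∀ᵐ t ∂volume.restrict (Set.Ioc x (x + 1 / b)), ∀ j : ℤ,
      e (t + j / b) = if j = 0 then 1 else 0 :=
    ae_all_iff.2 fun j => (ae_restrict_iff' measurableSet_Ioc).2
      (shiftInd_apply_ae measurableSet_Ioc measure_Ioc_lt_top.ne subset_rfl j 0)
  filter_upwards [hcolumn, hcell, ae_restrict_of_ae (hasSum_fiberMatrix_mul_ae hb ha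
    hg.hasUpperFrameBound (hg.frameEquiv.symm e))] with t hcol hone hwalnut j
  simpa only [hg.frameOperator_symm, hone, hcol] using hwalnut j

theorem uniformlySummable_enorm_ite_zero {Ω : Type*} (l : Filter Ω) :
    UniformlySummable l fun _ j => ‖if j = 0 then (1 : ℂ) else 0‖ₑ := by
  refine ⟨⟨1, ENNReal.one_ne_top, .of_forall fun _ => ?_⟩, fun ε _ => ⟨1, .of_forall fun _ => ?_⟩⟩
  · rw [tsum_eq_single 0 fun j hj => by simp [hj]]
    simp
  · refine le_of_eq_of_le (ENNReal.tsum_eq_zero.2 fun k => ?_) zero_le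
    have hk : (k : ℤ) ≠ 0 := abs_pos.1 (Int.lt_of_lt_of_le one_pos k.2)
    simp [hk]

end Dual

end WeylHeisenberg

end

open WeylHeisenberg

theorem theorem4p14 (a b : ℝ) (ha : 0 < a) (hb : 0 < b) (hab : ∃ r : ℚ, (r : ℝ) = a * b)
    (g : Lp ℂ 2 (volume : Measure ℝ)) (hg : WeylHeisenberg.IsFrame (WeylHeisenberg.whSystem g a b))
    (hcc : WeylHeisenberg.UniformCC g a b) :
    WeylHeisenberg.UniformCC (hg.frameEquiv.symm g) a b := by
  rw [uniformCC_iff ha hb] at hcc ⊢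
  have hdual := hasUpperFrameBound_whSystem_dual hg
  refine ⟨hdual, ?_⟩
  obtain ⟨A, hA, hlow⟩ := hg.exists_le_re_inner_frameOperator
  obtain ⟨m, hm, hdom⟩ := exists_uniformlySummable_enorm_fiberMatrix_le ha hb hab hcc.2
  obtain ⟨C, hC, hbdd⟩ := exists_enorm_fiberMatrix_le_ae ha hb hdual
  have hcolumn := uniformlySummable_enorm_of_coerciveWith hA hm (.of_forall hdom)
    (coerciveWith_fiberMatrix_ae ha hb hcc.1 hlow)
    (hbdd.mono fun t ht => ⟨C, hC, fun j => ht j 0⟩) (uniformlySummable_enorm_ite_zero _)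
    (hasSum_fiberMatrix_mul_fiberMatrix_dual_ae ha hb hg)
  simpa only [enorm_corr_eq_mul_enorm_fiberMatrix hb] using
    hcolumn.comp_neg.const_mul ENNReal.ofReal_ne_top
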